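/- **Setting.** Let $d\ge 1$, let $\Omega\subset\mathbb{R}^d$ be a bounded domain (nonempty, open, connected), let $a>0$, $b\in\mathbb{R}\setminus\{0\}$, $D>0$, and let $\widehat B=(\mu_1,\mu_2)\in\mathbb{R}^2$ with $|\mu_1|+|\mu_2|\neq 0$. Let $\Delta$ be the Dirichlet Laplacian on $L^2(\Omega;\mathbb{R})$, with domain $\{u\in H^1_0(\Omega):\Delta u\in L^2(\Omega)\}$. Let $\lambda_1\le\lambda_2\le\cdots$ be the eigenvalues of $-\Delta$, repeated according to multiplicity, let $\{e_i\}_{i\ge1}$ be corresponding eigenfunctions forming an orthonormal basis of $L^2(\Omega;\mathbb{R})$, and for $\lambda>\lambda_1$ put $k_\lambda:=\max\{i:\lambda_i\le\lambda\}$. Let $\{e^{\mathcal{A}t}\}_{t\ge0}$ be the strongly continuous semigroup on $L^2(\Omega;\mathbb{R}^2)$ generated by $$\mathcal{A}=\begin{pmatrix} a\Delta & -b\Delta\\ b\Delta & a\Delta\end{pmatrix},$$ where both components of an element of its domain lie in the domain of $\Delta$. Write $|\cdot|$ for Lebesgue measure and $\widehat B y=\mu_1y_1+\mu_2y_2$ for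 $y=(y_1,y_2)^\top$. **Proposition.** There is a constant $M>0$, depending only on $a,b,\mu_1,\mu_2,D$ (and on $\Omega$), with the following property. Let $T>0$, let $E\subset(0,T)$ be a measurable set of positive measure, and let $\{\mathcal{D}_t\}_{t\in(0,T)}$ be a family of subsets of $\Omega$ such that (a) for a.e. $t\in(0,T)$, $\mathcal{D}_t$ is measurable; (b) for every $f\in L^1(\Omega\times(0,T))$, the function $t\mapsto\int_\Omega\chi_{\mathcal{D}_t}(x)|f(x,t)|\,dx$ is integrable over $(0,T)$; (c) for a.e. $t\in E$, $$\sum_{i=1}^{k_\lambda}|a_i|^2\le D e^{D\sqrt{\lambda}}\Big(\Big\|\chi_{\mathcal{D}_t}\sum_{i=1}^{k_\lambda}a_ie_i\Big\|_{L^1(\Omega;\mathbb{R})}\Big)^2\quad\text{for all }\lambda>\lambda_1\text{ and all }\{a_i\}_{i=1}^{k_\lambda}\subset\mathbb{R}.$$ Then for all $\theta\in(0,1)$, all $0<S_1<S_2\le T$ with $|E\cap[S_1,S_2]|\neq0$ and all $z\in L^2(\Omega;\mathbb{R}^2)$, the function $t\mapsto\chi_E(t)\|\chi_{\mathcal{D}_t}\widehat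 B e^{\mathcal{A}t}z\|_{L^1(\Omega;\mathbb{R})}$ is integrable over $(S_1,S_2)$ and $$\|e^{\mathcal{A}S_2}z\|_{L^2(\Omega;\mathbb{R}^2)}\le \frac{M e^{M\left(\frac{S_2}{1-\theta}+\frac{1}{\theta S_1}\right)}}{|E\cap[S_1,S_2]|^3}\Big(\frac{1}{|E\cap[S_1,S_2]|}\int_{S_1}^{S_2}\chi_E(t)\big\|\chi_{\mathcal{D}_t}\widehat B e^{\mathcal{A}t}z\big\|_{L^1(\Omega;\mathbb{R})}\,dt\Big)^{1-\theta}\|z\|_{L^2(\Omega;\mathbb{R}^2)}^{\theta}.$$ -/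

import Mathlib

open MeasureTheory Set Filter Topology
open scoped ENNReal ContDiff

noncomputable section

namespace CoupledHeat

/-- The space `ℝ^d` with its Euclidean norm. -/
abbrev Space (d : ℕ) : Type := EuclideanSpace ℝ (Fin d)

/-- The real Hilbert space `L²(Ω; ℝ)`. -/
abbrev L2 {d : ℕ} (Ω : Set (Space d)) : Type := Lp ℝ 2 (volume.restrict Ω)

/-- The real Hilbert space `L²(Ω; ℝ²)` of pairs `y = (y₁, y₂)`, with
`‖y‖² = ‖y₁‖² + ‖y₂‖²`. -/
abbrev L2Pair {d : ℕ} (Ω : Set (Space d)) : Type := WithLp 2 (L2 Ω × L2 Ω)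

/-- `φ ∈ C_c^∞(Ω)`. -/
def IsTestFunction {d : ℕ} (Ω : Set (Space d)) (φ : Space d → ℝ) : Prop :=
  ContDiff ℝ ∞ φ ∧ HasCompactSupport φ ∧ tsupport φ ⊆ Ω

/-- `u ∈ H¹₀(Ω)` with weak gradient `G ∈ L²(Ω; ℝ^d)`: the pair `(u, G)` lies in the closure of
`{(φ, ∇φ) : φ ∈ C_c^∞(Ω)}` in `L²(Ω) × L²(Ω; ℝ^d)`. -/
def HasH10Gradient {d : ℕ} (Ω : Set (Space d)) (u : L2 Ω)
    (G : Lp (Space d) 2 (volume.restrict Ω)) : Prop :=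
  ∀ ε : ℝ≥0∞, 0 < ε → ∃ φ : Space d → ℝ, IsTestFunction Ω φ ∧
    eLpNorm (fun x => u x - φ x) 2 (volume.restrict Ω) < ε ∧
    eLpNorm (fun x => G x - gradient φ x) 2 (volume.restrict Ω) < ε

/-- Graph of the Dirichlet Laplacian on `L²(Ω; ℝ)`: `u ∈ H¹₀(Ω)`, and `Δu = f ∈ L²(Ω)` in the
sense of distributions. -/
def HasDirichletLaplacian {d : ℕ} (Ω : Set (Space d)) (u f : L2 Ω) : Prop :=
  ∃ G : Lp (Space d) 2 (volume.restrict Ω), HasH10Gradient Ω u G ∧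
    ∀ φ : Space d → ℝ, IsTestFunction Ω φ →
      ∫ x in Ω, inner ℝ (G x) (gradient φ x) = -∫ x in Ω, f x * φ x

/-- `lam 0 ≤ lam 1 ≤ ⋯` are the eigenvalues of `-Δ` under the homogeneous Dirichlet boundary
condition, repeated according to multiplicity, and `e 0, e 1, …` are corresponding
eigenfunctions forming an orthonormal basis of `L²(Ω; ℝ)`. (Indices start at `0`.) -/
structure IsDirichletEigenbasis {d : ℕ} (Ω : Set (Space d)) (lam : ℕ → ℝ)
    (e : HilbertBasis ℕ ℝ (L2 Ω)) : Prop where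
  monotone : Monotone lam
  eigen : ∀ i, HasDirichletLaplacian Ω (e i) (-(lam i • e i))

/-- Graph of the operator `𝒜 = [[aΔ, -bΔ], [bΔ, aΔ]]` on `L²(Ω; ℝ²)`, where both components of
the argument lie in the domain of the Dirichlet Laplacian: `𝒜 y = w`. -/
def HasCoupledOperator {d : ℕ} (Ω : Set (Space d)) (a b : ℝ) (y w : L2Pair Ω) : Prop :=
  ∃ f₁ f₂ : L2 Ω, HasDirichletLaplacian Ω y.fst f₁ ∧ HasDirichletLaplacian Ω y.snd f₂ ∧
    w.fst = a • f₁ - b • f₂ ∧ w.snd = b • f₁ + a • f₂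

/-- `(S t)_{t ≥ 0}` is a strongly continuous semigroup of bounded operators on `X` whose
infinitesimal generator has the graph `gen`. The values `S t` for `t < 0` play no role. -/
structure IsSemigroupGeneratedBy {X : Type*} [NormedAddCommGroup X] [NormedSpace ℝ X]
    (gen : X → X → Prop) (S : ℝ → X →L[ℝ] X) : Prop where
  zero : S 0 = ContinuousLinearMap.id ℝ X
  add : ∀ s t : ℝ, 0 ≤ s → 0 ≤ t → S (s + t) = (S s).comp (S t)
  continuous : ∀ z : X, Tendsto (fun t : ℝ => S t z) (𝓝[>] 0) (𝓝 z)
  generator : ∀ z w : X,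
    gen z w ↔ Tendsto (fun t : ℝ => t⁻¹ • (S t z - z)) (𝓝[>] 0) (𝓝 w)

/-- The semigroup `t ↦ e^{𝒜t}` on `L²(Ω; ℝ²)`: the strongly continuous semigroup generated by
`𝒜` (a strongly continuous semigroup is determined on `[0, ∞)` by its generator). -/
def coupledSemigroup {d : ℕ} (Ω : Set (Space d)) (a b : ℝ) : ℝ → L2Pair Ω →L[ℝ] L2Pair Ω :=
  Classical.epsilon (IsSemigroupGeneratedBy (HasCoupledOperator Ω a b))

/-- The norm `‖χ_U f‖_{L¹(Ω; ℝ)}`. -/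
def localL1Norm {d : ℕ} (Ω U : Set (Space d)) (f : Space d → ℝ) : ℝ :=
  ∫ x in Ω, U.indicator (fun x => |f x|) x

/-- The observation `‖χ_U B̂ y‖_{L¹(Ω; ℝ)}` with `B̂ = (μ₁, μ₂)`. -/
def observation {d : ℕ} (Ω U : Set (Space d)) (μ₁ μ₂ : ℝ) (y : L2Pair Ω) : ℝ :=
  localL1Norm Ω U (fun x => μ₁ * y.fst x + μ₂ * y.snd x)

/-- The spectral inequality on `U` with constant `D`. Here `n` ranges over the numbers with
`n ≤ k_Λ`, where `k_Λ` is the number of eigenvalues `≤ Λ`; the case `n = k_Λ` contains the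
others (extend the coefficients by zero). -/
def SpectralInequality {d : ℕ} (Ω : Set (Space d)) (lam : ℕ → ℝ) (e : HilbertBasis ℕ ℝ (L2 Ω))
    (D : ℝ) (U : Set (Space d)) : Prop :=
  ∀ Λ : ℝ, lam 0 < Λ → ∀ n : ℕ, (∀ i < n, lam i ≤ Λ) → ∀ c : ℕ → ℝ,
    ∑ i ∈ Finset.range n, c i ^ 2 ≤
      D * Real.exp (D * √Λ) *
        (localL1Norm Ω U (fun x => ∑ i ∈ Finset.range n, c i * e i x)) ^ 2

end CoupledHeat

end

/-! Expand both components in the eigenbasis and read the `i`-th pair of coefficients as one complex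
number. The system decouples: the `i`-th coordinate is multiplied by `exp (-(a + b I) λᵢ t)`. Its
observation through `(μ₁, μ₂)` is therefore a damped sine of frequency `|b| λᵢ`, whose amplitude is
`√(μ₁² + μ₂²)` times the modulus of the full coordinate (`exists_phase`). One scalar observation
misses a mode only near the zeros of that sine. Since Poincaré's inequality gives `λᵢ ≥ κ > 0`,
these zeros occupy a fraction of time controlled uniformly in `i`, so the integral of `sin²` over a
time set `F` is at least a constant times `|F|³`, whatever the phase (`le_setIntegral_sin_sq`). Here
`b ≠ 0` is essential.

At almost every time of `F`, the spectral inequality bounds the low modes of the observed function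
by its local `L¹` norm plus a high-frequency remainder. Integrating over `F` recovers the full
low-frequency amplitudes, because they only decrease and so dominate their values at `S₂`
(`sqrt_sum_sq_mul_le_setIntegral`). The frequencies above `Λ` have decayed by `exp (-a S₁ Λ)`. The
resulting estimate costs `exp (D √Λ / 2)` (`norm_le_of_cutoff`), and optimising over `Λ` gives the
interpolation inequality (`le_rpow_of_forall_cutoff`).

The semigroup is specified only through its generator, so the diagonal formula needs both existence
(`isSemigroupGeneratedBy_diagonal`) and uniqueness (`coord_apply`). -/

namespace CoupledHeat

/-! ### The Dirichlet Laplacian: Poincaré inequality and diagonalisation -/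

section Dirichlet

variable {d : ℕ} {Ω : Set (Space d)}

theorem IsTestFunction.add {φ ψ : Space d → ℝ} (hφ : IsTestFunction Ω φ)
    (hψ : IsTestFunction Ω ψ) : IsTestFunction Ω (φ + ψ) :=
  ⟨hφ.1.add hψ.1, hφ.2.1.add hψ.2.1,
    (tsupport_add φ ψ).trans (union_subset hφ.2.2 hψ.2.2)⟩

theorem IsTestFunction.const_smul {φ : Space d → ℝ} (hφ : IsTestFunction Ω φ) (c : ℝ) :
    IsTestFunction Ω (c • φ) :=
  ⟨hφ.1.const_smul c, hφ.2.1.smul_left (f := fun _ => c),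
    (closure_mono (Function.support_const_smul_subset c φ)).trans hφ.2.2⟩

theorem IsTestFunction.zero : IsTestFunction Ω (0 : Space d → ℝ) :=
  ⟨contDiff_const, HasCompactSupport.zero, by simp [tsupport]⟩

theorem IsTestFunction.differentiable {φ : Space d → ℝ} (hφ : IsTestFunction Ω φ) :
    Differentiable ℝ φ := hφ.1.differentiable (by simp)

theorem IsTestFunction.gradient_add {φ ψ : Space d → ℝ} (hφ : IsTestFunction Ω φ)
    (hψ : IsTestFunction Ω ψ) (x : Space d) :
    gradient (φ + ψ) x = gradient φ x + gradient ψ x := by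
  simp only [gradient, fderiv_add (hφ.differentiable x) (hψ.differentiable x), map_add]

theorem IsTestFunction.gradient_const_smul {φ : Space d → ℝ} (hφ : IsTestFunction Ω φ)
    (c : ℝ) (x : Space d) : gradient (c • φ) x = c • gradient φ x := by
  simp [gradient, fderiv_const_smul (hφ.differentiable x)]

theorem gradient_zero_apply (x : Space d) : gradient (0 : Space d → ℝ) x = 0 := by
  simp [gradient]

theorem IsTestFunction.continuous_gradient {φ : Space d → ℝ} (hφ : IsTestFunction Ω φ) :
    Continuous (gradient φ) :=
  (InnerProductSpace.toDual ℝ (Space d)).symm.continuous.comp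
    (hφ.1.continuous_fderiv (by simp))

theorem IsTestFunction.hasCompactSupport_gradient {φ : Space d → ℝ} (hφ : IsTestFunction Ω φ) :
    HasCompactSupport (gradient φ) :=
  (hφ.2.1.fderiv ℝ).comp_left (g := (InnerProductSpace.toDual ℝ (Space d)).symm) (map_zero _)

theorem IsTestFunction.memLp {φ : Space d → ℝ} (hφ : IsTestFunction Ω φ) :
    MemLp φ 2 (volume.restrict Ω) :=
  (hφ.1.continuous.memLp_of_hasCompactSupport hφ.2.1).restrict Ω

theorem IsTestFunction.memLp_gradient {φ : Space d → ℝ} (hφ : IsTestFunction Ω φ) :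
    MemLp (gradient φ) 2 (volume.restrict Ω) :=
  (hφ.continuous_gradient.memLp_of_hasCompactSupport hφ.hasCompactSupport_gradient).restrict Ω

variable (Ω) in
/-- The pairs `(φ, ∇φ)` with `φ` a test function, in `L²(Ω) × L²(Ω; ℝ^d)`. -/
def testGraph : Submodule ℝ (L2 Ω × Lp (Space d) 2 (volume.restrict Ω)) where
  carrier := {p | ∃ φ, IsTestFunction Ω φ ∧ p.1 =ᵐ[volume.restrict Ω] φ ∧
    p.2 =ᵐ[volume.restrict Ω] gradient φ}
  add_mem' := by
    rintro p q ⟨φ, hφ, h1, h2⟩ ⟨ψ, hψ, h3, h4⟩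
    refine ⟨φ + ψ, hφ.add hψ, ?_, ?_⟩
    · filter_upwards [Lp.coeFn_add p.1 q.1, h1, h3] with x hx h1 h3
      exact hx.trans (by simp [h1, h3])
    · filter_upwards [Lp.coeFn_add p.2 q.2, h2, h4] with x hx h1 h3
      exact hx.trans (by simp [h1, h3, hφ.gradient_add hψ])
  zero_mem' := by
    refine ⟨0, IsTestFunction.zero, Lp.coeFn_zero _ _ _, ?_⟩
    filter_upwards [Lp.coeFn_zero (Space d) 2 (volume.restrict Ω)] with x hx
    exact hx.trans (gradient_zero_apply x).symm
  smul_mem' := by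
    rintro c p ⟨φ, hφ, h1, h2⟩
    refine ⟨c • φ, hφ.const_smul c, ?_, ?_⟩
    · filter_upwards [Lp.coeFn_smul c p.1, h1] with x hx h1
      simp [hx, h1]
    · filter_upwards [Lp.coeFn_smul c p.2, h2] with x hx h1
      simp [hx, h1, hφ.gradient_const_smul]

/-- Membership in a closed subspace is what allows identities to pass from test functions to
`H¹₀(Ω)`, and eigenfunction series to be summed inside it. -/
theorem hasH10Gradient_iff (u : L2 Ω) (G : Lp (Space d) 2 (volume.restrict Ω)) :
    HasH10Gradient Ω u G ↔ (u, G) ∈ (testGraph Ω).topologicalClosure := by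
  rw [← SetLike.mem_coe, Submodule.topologicalClosure_coe, EMetric.mem_closure_iff]
  refine forall₂_congr fun ε _ => ⟨?_, ?_⟩
  · rintro ⟨φ, hφ, h1, h2⟩
    refine ⟨(hφ.memLp.toLp φ, hφ.memLp_gradient.toLp _), ⟨φ, hφ, hφ.memLp.coeFn_toLp,
      hφ.memLp_gradient.coeFn_toLp⟩, ?_⟩
    rw [Prod.edist_eq, max_lt_iff, Lp.edist_def, Lp.edist_def]
    refine ⟨(eLpNorm_congr_ae ?_).trans_lt h1, (eLpNorm_congr_ae ?_).trans_lt h2⟩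
    · filter_upwards [hφ.memLp.coeFn_toLp] with x hx
      simp [hx]
    · filter_upwards [hφ.memLp_gradient.coeFn_toLp] with x hx
      simp [hx]
  · rintro ⟨p, ⟨φ, hφ, h1, h2⟩, h⟩
    rw [Prod.edist_eq, max_lt_iff, Lp.edist_def, Lp.edist_def] at h
    refine ⟨φ, hφ, (eLpNorm_congr_ae ?_).trans_lt h.1, (eLpNorm_congr_ae ?_).trans_lt h.2⟩
    · filter_upwards [h1] with x hx
      simp [hx]
    · filter_upwards [h2] with x hx
      simp [hx]

/-- The weak formulation of the Dirichlet Laplacian may be tested against all of `H¹₀(Ω)`. -/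
theorem inner_gradient_eq_of_weak {f : L2 Ω} {G : Lp (Space d) 2 (volume.restrict Ω)}
    (h : ∀ φ : Space d → ℝ, IsTestFunction Ω φ →
      ∫ x in Ω, inner ℝ (G x) (gradient φ x) = -∫ x in Ω, f x * φ x)
    {v : L2 Ω} {H : Lp (Space d) 2 (volume.restrict Ω)} (hv : HasH10Gradient Ω v H) :
    inner ℝ G H = -inner ℝ f v := by
  rw [hasH10Gradient_iff] at hv
  have hcl : IsClosed {p : L2 Ω × Lp (Space d) 2 (volume.restrict Ω) |
      inner ℝ G p.2 = -inner ℝ f p.1} := isClosed_eq (by fun_prop) (by fun_prop)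
  refine closure_minimal (s := (testGraph Ω : Set _)) ?_ hcl hv
  rintro p ⟨φ, hφ, h1, h2⟩
  have := h φ hφ
  simp only [mem_ofPred_eq, L2.inner_def]
  rw [integral_congr_ae (g := fun x => inner ℝ (G x) (gradient φ x)), this]
  · congr 1
    refine integral_congr_ae ?_
    filter_upwards [h1] with x hx
    simp [hx, mul_comm]
  · filter_upwards [h2] with x hx
    simp [hx]

theorem weak_of_inner_gradient_eq {f : L2 Ω} {G : Lp (Space d) 2 (volume.restrict Ω)}
    (h : ∀ p ∈ testGraph Ω, inner ℝ G p.2 = -inner ℝ f p.1)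
    (φ : Space d → ℝ) (hφ : IsTestFunction Ω φ) :
    ∫ x in Ω, inner ℝ (G x) (gradient φ x) = -∫ x in Ω, f x * φ x := by
  have := h (hφ.memLp.toLp φ, hφ.memLp_gradient.toLp _) ⟨φ, hφ, hφ.memLp.coeFn_toLp,
      hφ.memLp_gradient.coeFn_toLp⟩
  simp only [L2.inner_def] at this
  rw [integral_congr_ae (g := fun x => inner ℝ (G x) (gradient φ x))] at this
  · rw [this]
    congr 1
    refine integral_congr_ae ?_
    filter_upwards [hφ.memLp.coeFn_toLp] with x hx
    simp [hx, mul_comm]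
  · filter_upwards [hφ.memLp_gradient.coeFn_toLp] with x hx
    simp [hx]

/-- Integrate by parts against a coordinate function: it has derivative `1` in its own direction and
is bounded by `R` on `Ω`. -/
theorem IsTestFunction.integral_sq_le (hd : 1 ≤ d) {R : ℝ} (hR : ∀ x ∈ Ω, ‖x‖ ≤ R)
    {φ : Space d → ℝ} (hφ : IsTestFunction Ω φ) :
    ∫ x, φ x ^ 2 ≤ 4 * R ^ 2 * ∫ x, ‖gradient φ x‖ ^ 2 := by
  let i : Fin d := ⟨0, hd⟩
  let v : Space d := EuclideanSpace.single i 1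
  let ℓ : Space d →L[ℝ] ℝ := EuclideanSpace.proj i
  have hv : ℓ v = 1 := by simp [ℓ, v]
  have hsq : HasCompactSupport (fun x => φ x ^ 2) :=
    hφ.2.1.comp_left (g := fun t : ℝ => t ^ 2) (by simp)
  have hgsq : HasCompactSupport (fun x => ‖gradient φ x‖ ^ 2) :=
    hφ.hasCompactSupport_gradient.comp_left (g := fun t => ‖t‖ ^ 2) (by simp)
  have hc := hφ.1.continuous
  have hcg := hφ.continuous_gradient
  have hcd : Continuous fun x => fderiv ℝ φ x v :=
    (hφ.1.continuous_fderiv (by simp)).clm_apply continuous_const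
  have hder : ∀ x, fderiv ℝ (fun x => φ x ^ 2) x v = 2 * φ x * fderiv ℝ φ x v := by
    intro x
    rw [fderiv_fun_pow 2 (hφ.differentiable x)]
    simp
  have hI1 : Integrable (fun x => φ x ^ 2) :=
    (by fun_prop : Continuous fun x => φ x ^ 2).integrable_of_hasCompactSupport hsq
  have hI2 : Integrable (fun x => ‖gradient φ x‖ ^ 2) :=
    (by fun_prop : Continuous fun x => ‖gradient φ x‖ ^ 2).integrable_of_hasCompactSupport hgsq
  have hI3 : Integrable (fun x => ℓ x * φ x ^ 2) :=
    (by fun_prop : Continuous fun x => ℓ x * φ x ^ 2).integrable_of_hasCompactSupport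
      hsq.mul_left
  have hI4 : Integrable (fun x => ℓ x * (2 * φ x * fderiv ℝ φ x v)) :=
    (by fun_prop : Continuous fun x => ℓ x * (2 * φ x * fderiv ℝ φ x v))
      |>.integrable_of_hasCompactSupport
      ((hφ.2.1.mul_left (f := fun _ => (2 : ℝ))).mul_right.mul_left)
  have key := integral_mul_fderiv_eq_neg_fderiv_mul_of_integrable (𝕜 := ℝ)
    (f := fun x : Space d => ℓ x) (g := fun x => φ x ^ 2) (v := v) (μ := volume)
    (by simpa [hv] using hI1) (by simpa only [hder] using hI4) hI3
    (fun x _ => ℓ.differentiable x) (fun x _ => (hφ.differentiable x).fun_pow 2)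
  simp only [hder, ContinuousLinearMap.fderiv, hv, one_mul] at key
  have hb : ∀ x, -(ℓ x * (2 * φ x * fderiv ℝ φ x v)) ≤
      φ x ^ 2 / 2 + 2 * R ^ 2 * ‖gradient φ x‖ ^ 2 := by
    intro x
    by_cases hx : x ∈ Ω
    · have h1 : |ℓ x| ≤ R := (by simpa [ℓ] using PiLp.norm_apply_le x i : |ℓ x| ≤ ‖x‖).trans
        (hR x hx)
      have h2 : |fderiv ℝ φ x v| ≤ ‖gradient φ x‖ := by
        have := (fderiv ℝ φ x).le_opNorm v
        simpa [gradient, v] using this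
      have h3 : |ℓ x * fderiv ℝ φ x v| ≤ R * ‖gradient φ x‖ := by
        rw [abs_mul]
        exact mul_le_mul h1 h2 (abs_nonneg _) ((abs_nonneg _).trans h1)
      have h4 := pow_le_pow_left₀ (abs_nonneg _) h3 2
      rw [sq_abs] at h4
      -- Young's inequality weighted so that half of `φ²` remains to be absorbed on the left, whence
      -- the constant `4 R²`.
      nlinarith [sq_nonneg (φ x + 2 * (ℓ x * fderiv ℝ φ x v))]
    · have : φ x = 0 := by
        by_contra h
        exact hx (hφ.2.2 (subset_tsupport φ h))
      simp only [this]
      have : 0 ≤ 2 * R ^ 2 * ‖gradient φ x‖ ^ 2 := by positivity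
      linarith
  have := integral_mono hI4.neg ((hI1.div_const 2).add (hI2.const_mul (2 * R ^ 2))) hb
  simp only [Pi.neg_apply, Pi.add_apply] at this
  rw [integral_neg, integral_add (hI1.div_const 2) (hI2.const_mul _), integral_div,
    integral_const_mul] at this
  linarith

theorem IsTestFunction.setIntegral_eq {φ : Space d → ℝ} (hφ : IsTestFunction Ω φ) :
    ∫ x in Ω, φ x ^ 2 = ∫ x, φ x ^ 2 := by
  refine setIntegral_eq_integral_of_forall_compl_eq_zero fun x hx => ?_
  have : φ x = 0 := by
    by_contra h
    exact hx (hφ.2.2 (subset_tsupport φ h))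
  simp [this]

theorem IsTestFunction.setIntegral_gradient_eq {φ : Space d → ℝ} (hφ : IsTestFunction Ω φ) :
    ∫ x in Ω, ‖gradient φ x‖ ^ 2 = ∫ x, ‖gradient φ x‖ ^ 2 := by
  refine setIntegral_eq_integral_of_forall_compl_eq_zero fun x hx => ?_
  have : fderiv ℝ φ x = 0 := by
    by_contra h
    exact hx (hφ.2.2 (support_fderiv_subset ℝ h))
  simp [gradient, this]

theorem norm_sq_eq_integral {F : Type*} [NormedAddCommGroup F] [InnerProductSpace ℝ F]
    {α : Type*} [MeasurableSpace α] {μ : Measure α} (u : Lp F 2 μ) :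
    ‖u‖ ^ 2 = ∫ x, ‖u x‖ ^ 2 ∂μ := by
  rw [← real_inner_self_eq_norm_sq, L2.inner_def]
  simp only [real_inner_self_eq_norm_sq]

/-- The Poincaré inequality in `H¹₀(Ω)`. -/
theorem norm_sq_le_of_hasH10Gradient (hd : 1 ≤ d) {R : ℝ} (hR : ∀ x ∈ Ω, ‖x‖ ≤ R) {u : L2 Ω}
    {G : Lp (Space d) 2 (volume.restrict Ω)} (h : HasH10Gradient Ω u G) :
    ‖u‖ ^ 2 ≤ 4 * R ^ 2 * ‖G‖ ^ 2 := by
  rw [hasH10Gradient_iff] at h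
  have hcl : IsClosed {p : L2 Ω × Lp (Space d) 2 (volume.restrict Ω) |
      ‖p.1‖ ^ 2 ≤ 4 * R ^ 2 * ‖p.2‖ ^ 2} :=
    isClosed_le (continuous_fst.norm.pow 2) (continuous_const.mul (continuous_snd.norm.pow 2))
  suffices hs : (testGraph Ω : Set (L2 Ω × Lp (Space d) 2 (volume.restrict Ω))) ⊆
      {p | ‖p.1‖ ^ 2 ≤ 4 * R ^ 2 * ‖p.2‖ ^ 2} by
    have h' : (u, G) ∈ closure (testGraph Ω : Set (L2 Ω × Lp (Space d) 2 (volume.restrict Ω))) := h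
    have := closure_minimal hs hcl h'
    rwa [mem_ofPred_eq] at this
  rintro p ⟨φ, hφ, h1, h2⟩
  have e1 : ‖p.1‖ ^ 2 = ∫ x, φ x ^ 2 := by
    rw [norm_sq_eq_integral, ← hφ.setIntegral_eq]
    refine integral_congr_ae ?_
    filter_upwards [h1] with x hx
    rw [hx, Real.norm_eq_abs, sq_abs]
  have e2 : ‖p.2‖ ^ 2 = ∫ x, ‖gradient φ x‖ ^ 2 := by
    rw [norm_sq_eq_integral, ← hφ.setIntegral_gradient_eq]
    refine integral_congr_ae ?_
    filter_upwards [h2] with x hx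
    rw [hx]
  rw [mem_ofPred_eq, e1, e2]
  exact hφ.integral_sq_le hd hR

variable {lam : ℕ → ℝ} {e : HilbertBasis ℕ ℝ (L2 Ω)}

/-- Test the eigenvalue equation with `e i` itself and apply Poincaré. The bound depends only on the
size of `Ω`, which lets the final constant be fixed before the eigenbasis. -/
theorem IsDirichletEigenbasis.eigenvalue_ge (he : IsDirichletEigenbasis Ω lam e)
    (hd : 1 ≤ d) {R : ℝ} (hR : ∀ x ∈ Ω, ‖x‖ ≤ R) (i : ℕ) : 1 ≤ 4 * R ^ 2 * lam i := by
  obtain ⟨G, hG, hw⟩ := he.eigen i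
  have h1 := norm_sq_le_of_hasH10Gradient hd hR hG
  have h2 := inner_gradient_eq_of_weak hw hG
  have h3 : ‖e i‖ = 1 := e.orthonormal.1 i
  rw [inner_neg_left, neg_neg, real_inner_smul_left, real_inner_self_eq_norm_sq,
    real_inner_self_eq_norm_sq, h3] at h2
  rw [h2, h3] at h1
  linarith

/-- The Dirichlet Laplacian acts diagonally on an eigenbasis. -/
theorem IsDirichletEigenbasis.hasDirichletLaplacian_iff (he : IsDirichletEigenbasis Ω lam e)
    (hlam : ∀ i, 0 < lam i) (u f : L2 Ω) :
    HasDirichletLaplacian Ω u f ↔ ∀ i, inner ℝ (e i) f = -(lam i * inner ℝ (e i) u) := by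
  choose G hG hw using he.eigen
  constructor
  · rintro ⟨H, hH, hwH⟩ i
    -- Green's formula in both orders: `u` tested with `e i`, then `e i` tested with `u`.
    have h1 := inner_gradient_eq_of_weak hwH (hG i)
    have h2 := inner_gradient_eq_of_weak (hw i) hH
    rw [inner_neg_left, neg_neg, real_inner_smul_left] at h2
    rw [real_inner_comm, h2, real_inner_comm _ f] at h1
    linarith
  · intro h
    have hGG : ∀ i j, inner ℝ (G i) (G j) = lam i * inner ℝ (e i) (e j) := by
      intro i j
      have := inner_gradient_eq_of_weak (hw i) (hG j)
      rwa [inner_neg_left, neg_neg, real_inner_smul_left] at this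
    have horth := orthonormal_iff_ite.1 e.orthonormal
    -- The gradients of the eigenfunctions are orthogonal with squared norms `lam i`; once
    -- normalised, summing the gradient series reduces to square summability of its coefficients.
    set g : ℕ → Lp (Space d) 2 (volume.restrict Ω) := fun i => (√(lam i))⁻¹ • G i with hg
    have hgo : Orthonormal ℝ g := by
      rw [orthonormal_iff_ite]
      intro i j
      simp only [hg, real_inner_smul_left, real_inner_smul_right, hGG, horth]
      split_ifs with hij
      · subst hij
        have := Real.sqrt_pos.2 (hlam i)
        have h2 := Real.mul_self_sqrt (hlam i).le
        field_simp
        nlinarith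
      · simp
    have hsu : HasSum (fun i => inner ℝ (e i) u • e i) u := by
      simpa [e.repr_apply_apply] using e.hasSum_repr u
    have hs2 : Summable fun i => lam i * inner ℝ (e i) u ^ 2 := by
      -- The Dirichlet energy series is, up to sign, the Parseval series of the pairing of `u` with
      -- `f`, hence finite.
      have := (e.summable_inner_mul_inner u f).neg
      refine this.congr fun i => ?_
      rw [h i, real_inner_comm]
      ring
    have hsG : Summable fun i => inner ℝ (e i) u • G i := by
      have := (hgo.orthogonalFamily.summable_iff_norm_sq_summable
        (fun i => √(lam i) * inner ℝ (e i) u)).2 ?_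
      · refine this.congr fun i => ?_
        have := Real.sqrt_pos.2 (hlam i)
        simp only [LinearIsometry.toSpanSingleton_apply, hg, smul_smul]
        congr 1
        field_simp
      · refine hs2.congr fun i => ?_
        rw [Real.norm_eq_abs, sq_abs, mul_pow, Real.sq_sqrt (hlam i).le]
    obtain ⟨H, hH⟩ := hsG
    refine ⟨H, ?_, weak_of_inner_gradient_eq fun p hp => ?_⟩
    · rw [hasH10Gradient_iff]
      refine ((testGraph Ω).isClosed_topologicalClosure).mem_of_tendsto
        ((hsu.prodMk hH)) (Eventually.of_forall fun s => ?_)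
      refine Submodule.sum_mem _ fun i _ => ?_
      exact Submodule.smul_mem _ (inner ℝ (e i) u) ((hasH10Gradient_iff _ _).1 (hG i))
    · have hp' : HasH10Gradient Ω p.1 p.2 :=
        (hasH10Gradient_iff _ _).2 (subset_closure hp)
      have h1 : HasSum (fun i => inner ℝ (inner ℝ (e i) u • G i) p.2) (inner ℝ H p.2) :=
        by
        simpa only [innerSL_apply_apply, real_inner_comm p.2] using hH.mapL (innerSL ℝ p.2)
      have h2 := (e.hasSum_inner_mul_inner f p.1).neg
      refine h1.unique (h2.congr_fun ?_)
      intro i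
      rw [real_inner_smul_left, inner_gradient_eq_of_weak (hw i) hp', inner_neg_left, neg_neg,
        real_inner_smul_left, real_inner_comm (e i) f, h i]
      ring

end Dirichlet

/-! ### Complex coordinates on pairs -/

section Coordinates

variable {H : Type*} [NormedAddCommGroup H] [InnerProductSpace ℝ H] (e : HilbertBasis ℕ ℝ H)

/-- The `i`-th coordinate of `y = (y₁, y₂)`, as the complex number `⟨eᵢ, y₁⟩ + i ⟨eᵢ, y₂⟩`. -/
noncomputable def coord (i : ℕ) : WithLp 2 (H × H) →L[ℝ] ℂ :=
  (Complex.equivRealProdCLM.symm : ℝ × ℝ →L[ℝ] ℂ) ∘L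
    ((innerSL ℝ (e i)).prodMap (innerSL ℝ (e i))) ∘L
      (WithLp.prodContinuousLinearEquiv 2 ℝ H H : WithLp 2 (H × H) →L[ℝ] H × H)

theorem coord_re (i : ℕ) (y : WithLp 2 (H × H)) : (coord e i y).re = inner ℝ (e i) y.fst := by
  simp [coord]

theorem coord_im (i : ℕ) (y : WithLp 2 (H × H)) : (coord e i y).im = inner ℝ (e i) y.snd := by
  simp [coord]

theorem hasSum_inner_sq (v : H) : HasSum (fun i => inner ℝ (e i) v ^ 2) (‖v‖ ^ 2) := by
  have := e.hasSum_inner_mul_inner v v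
  rw [real_inner_self_eq_norm_sq] at this
  refine this.congr_fun fun i => ?_
  rw [real_inner_comm, sq]

theorem exists_inner_eq {g : ℕ → ℝ} (hg : Summable fun i => g i ^ 2) :
    ∃ v : H, ∀ i, inner ℝ (e i) v = g i := by
  have hm : Memℓp g 2 := by
    refine (memℓp_gen_iff (by norm_num)).2 (hg.congr fun i => ?_)
    simp
  refine ⟨e.repr.symm ⟨g, hm⟩, fun i => ?_⟩
  rw [← e.repr_apply_apply, LinearIsometryEquiv.apply_symm_apply]

theorem hasSum_norm_coord_sq (y : WithLp 2 (H × H)) :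
    HasSum (fun i => ‖coord e i y‖ ^ 2) (‖y‖ ^ 2) := by
  rw [WithLp.prod_norm_sq_eq_of_L2]
  refine ((hasSum_inner_sq e y.fst).add
    (hasSum_inner_sq e y.snd)).congr_fun fun i => ?_
  rw [← Complex.normSq_eq_norm_sq, Complex.normSq_apply, coord_re, coord_im]
  ring

theorem exists_coord_eq {g : ℕ → ℂ} (hg : Summable fun i => ‖g i‖ ^ 2) :
    ∃ y : WithLp 2 (H × H), ∀ i, coord e i y = g i := by
  obtain ⟨u, hu⟩ := exists_inner_eq e (g := fun i => (g i).re)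
    (hg.of_nonneg_of_le (fun i => sq_nonneg _) fun i => by
      rw [← sq_abs]; exact pow_le_pow_left₀ (abs_nonneg _) (Complex.abs_re_le_norm _) 2)
  obtain ⟨v, hv⟩ := exists_inner_eq e (g := fun i => (g i).im)
    (hg.of_nonneg_of_le (fun i => sq_nonneg _) fun i => by
      rw [← sq_abs]; exact pow_le_pow_left₀ (abs_nonneg _) (Complex.abs_im_le_norm _) 2)
  refine ⟨WithLp.toLp 2 (u, v), fun i => Complex.ext ?_ ?_⟩
  · simp [coord_re, hu]
  · simp [coord_im, hv]

variable {e} in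
theorem ext_coord {y z : WithLp 2 (H × H)} (h : ∀ i, coord e i y = coord e i z) : y = z := by
  have := hasSum_norm_coord_sq e (y - z)
  simp only [map_sub, h, sub_self, norm_zero, ne_eq, OfNat.ofNat_ne_zero, not_false_eq_true,
    zero_pow] at this
  have h0 := this.unique hasSum_zero
  rw [← sub_eq_zero, ← norm_eq_zero]
  exact pow_eq_zero_iff two_ne_zero |>.1 h0

/-- Dominated convergence in the Parseval series of the squared norm. -/
theorem tendsto_zero_of_coord {ι : Type*} {l : Filter ι} {x : ι → WithLp 2 (H × H)} {g : ℕ → ℝ}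
    (hg : Summable g) (hb : ∀ᶠ t in l, ∀ i, ‖coord e i (x t)‖ ^ 2 ≤ g i)
    (hx : ∀ i, Tendsto (fun t => coord e i (x t)) l (𝓝 0)) : Tendsto x l (𝓝 0) := by
  have h := tendsto_tsum_of_dominated_convergence (f := fun t i => ‖coord e i (x t)‖ ^ 2)
    (g := fun _ => (0 : ℝ)) (𝓕 := l) hg
    (fun i => by simpa using ((hx i).norm.pow 2))
    (by filter_upwards [hb] with t ht i; simpa using ht i)
  simp only [(hasSum_norm_coord_sq e _).tsum_eq, tsum_zero] at h
  rw [tendsto_zero_iff_norm_tendsto_zero]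
  have := h.sqrt
  simpa using this

/-- The operator on pairs multiplying the `i`-th coordinate by `m i`. -/
noncomputable def multiplier (m : ℕ → ℂ) (hm : ∀ i, ‖m i‖ ≤ 1) :
    WithLp 2 (H × H) →L[ℝ] WithLp 2 (H × H) :=
  have hex : ∀ z : WithLp 2 (H × H), ∃ y, ∀ i, coord e i y = m i * coord e i z := fun z =>
    exists_coord_eq e (by
      refine (hasSum_norm_coord_sq e z).summable.of_nonneg_of_le (fun i => by positivity)
        fun i => ?_
      rw [norm_mul]
      exact pow_le_pow_left₀ (by positivity) (mul_le_of_le_one_left (norm_nonneg _) (hm i)) 2)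
  LinearMap.mkContinuous
    { toFun := fun z => (hex z).choose
      map_add' := fun y z => ext_coord (e := e) fun i => by
        rw [map_add, (hex _).choose_spec, (hex _).choose_spec, (hex _).choose_spec, map_add,
          mul_add]
      map_smul' := fun c z => ext_coord (e := e) fun i => by
        rw [map_smul, (hex _).choose_spec, (hex _).choose_spec, map_smul, RingHom.id_apply,
          mul_smul_comm] } 1 fun z => by
    rw [one_mul]
    refine abs_le_of_sq_le_sq' ?_ (norm_nonneg _) |>.2
    refine hasSum_le (fun i => ?_) (hasSum_norm_coord_sq e _) (hasSum_norm_coord_sq e z)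
    rw [LinearMap.coe_mk, AddHom.coe_mk, (hex _).choose_spec, norm_mul]
    exact pow_le_pow_left₀ (by positivity) (mul_le_of_le_one_left (norm_nonneg _) (hm i)) 2

theorem coord_multiplier (m : ℕ → ℂ) (hm : ∀ i, ‖m i‖ ≤ 1) (z : WithLp 2 (H × H)) (i : ℕ) :
    coord e i (multiplier e m hm z) = m i * coord e i z := by
  have hex : ∀ z : WithLp 2 (H × H), ∃ y, ∀ i, coord e i y = m i * coord e i z := fun z =>
    exists_coord_eq e (by
      refine (hasSum_norm_coord_sq e z).summable.of_nonneg_of_le (fun i => by positivity)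
        fun i => ?_
      rw [norm_mul]
      exact pow_le_pow_left₀ (by positivity) (mul_le_of_le_one_left (norm_nonneg _) (hm i)) 2)
  -- By proof irrelevance this is the same choice as the one made inside `multiplier`.
  exact (hex z).choose_spec i

end Coordinates

/-! ### Strongly continuous semigroups: boundedness, continuity, right derivatives -/

section Semigroup

variable {X : Type*} [NormedAddCommGroup X] [NormedSpace ℝ X] {gen : X → X → Prop}
  {S : ℝ → X →L[ℝ] X}

theorem IsSemigroupGeneratedBy.tendsto_Ici (hS : IsSemigroupGeneratedBy gen S) (z : X) :
    Tendsto (fun t => S t z) (𝓝[≥] 0) (𝓝 z) := by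
  have : ContinuousWithinAt (fun t => S t z) (Ioi 0) 0 := by
    simpa [ContinuousWithinAt, hS.zero] using hS.continuous z
  simpa [ContinuousWithinAt, hS.zero] using continuousWithinAt_Ioi_iff_Ici.1 this

/-- Otherwise the norms would be unbounded along some times tending to `0`, although every orbit
converges along them; this contradicts Banach–Steinhaus. -/
theorem IsSemigroupGeneratedBy.exists_bound_near_zero [CompleteSpace X]
    (hS : IsSemigroupGeneratedBy gen S) :
    ∃ δ > 0, ∃ C, ∀ t, 0 ≤ t → t ≤ δ → ‖S t‖ ≤ C := by
  by_contra! h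
  choose t ht0 ht hC using fun n : ℕ => h (1 / ((n : ℝ) + 1)) (by positivity) (n : ℝ)
  have ht' : Tendsto t atTop (𝓝[≥] 0) := tendsto_nhdsWithin_iff.2
    ⟨squeeze_zero ht0 ht tendsto_one_div_add_atTop_nhds_zero_nat, Eventually.of_forall ht0⟩
  obtain ⟨C, hCb⟩ := banach_steinhaus (g := fun n => S (t n)) fun z => by
    obtain ⟨C, hC⟩ := (Metric.isBounded_range_of_tendsto _
      ((hS.tendsto_Ici z).comp ht')).exists_norm_le
    exact ⟨C, fun i => hC _ ⟨i, rfl⟩⟩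
  obtain ⟨n, hn⟩ := exists_nat_gt C
  exact absurd (hCb n) (not_le.2 (hn.trans (hC n)))

theorem IsSemigroupGeneratedBy.exists_bound [CompleteSpace X]
    (hS : IsSemigroupGeneratedBy gen S) (T : ℝ) :
    ∃ C, ∀ t, 0 ≤ t → t ≤ T → ‖S t‖ ≤ C := by
  obtain ⟨δ, hδ, C, hC⟩ := hS.exists_bound_near_zero
  have hC0 : 0 ≤ C := (norm_nonneg _).trans (hC 0 le_rfl hδ.le)
  have hind : ∀ n : ℕ, ∃ K, ∀ t, 0 ≤ t → t ≤ n * δ → ‖S t‖ ≤ K := by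
    intro n
    induction n with
    | zero => exact ⟨C, fun t h0 h1 => hC t h0 (by simp at h1; linarith)⟩
    | succ n ih =>
      obtain ⟨K, hK⟩ := ih
      refine ⟨max C (C * K), fun t h0 h1 => ?_⟩
      rcases le_total t δ with h | h
      · exact (hC t h0 h).trans (le_max_left _ _)
      · have hs : S t = (S δ).comp (S (t - δ)) := by
          rw [← hS.add δ (t - δ) hδ.le (by linarith)]; simp
        rw [hs]
        refine (ContinuousLinearMap.opNorm_comp_le _ _).trans
          ((mul_le_mul (hC δ hδ.le le_rfl) (hK _ (by linarith) ?_) (norm_nonneg _) hC0).trans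
            (le_max_right _ _))
        push_cast at h1
        linarith
  obtain ⟨n, hn⟩ := exists_nat_ge (T / δ)
  obtain ⟨K, hK⟩ := hind n
  exact ⟨K, fun t h0 h1 => hK t h0 (h1.trans ((div_le_iff₀ hδ).1 hn))⟩

theorem IsSemigroupGeneratedBy.apply_add (hS : IsSemigroupGeneratedBy gen S) {s t : ℝ}
    (hs : 0 ≤ s) (ht : 0 ≤ t) (z : X) : S (s + t) z = S s (S t z) := by
  rw [hS.add s t hs ht, ContinuousLinearMap.comp_apply]

theorem IsSemigroupGeneratedBy.continuousOn [CompleteSpace X]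
    (hS : IsSemigroupGeneratedBy gen S) (T : ℝ) (z : X) :
    ContinuousOn (fun t => S t z) (Icc 0 T) := by
  obtain ⟨C, hC⟩ := hS.exists_bound T
  have hle : ∀ s t, 0 ≤ s → s ≤ t → t ≤ T → ‖S t z - S s z‖ ≤ C * ‖S (t - s) z - z‖ := by
    intro s t hs hst ht
    have : S t z - S s z = S s (S (t - s) z - z) := by
      rw [map_sub, ← hS.apply_add hs (by linarith)]
      simp
    rw [this]
    exact (S s).le_of_opNorm_le (hC s hs (hst.trans ht)) _
  intro s hs
  rw [ContinuousWithinAt, tendsto_iff_norm_sub_tendsto_zero]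
  have habs : Tendsto (fun t => |t - s|) (𝓝[Icc 0 T] s) (𝓝[≥] 0) := by
    refine tendsto_nhdsWithin_iff.2 ⟨?_, Eventually.of_forall fun t => mem_Ici.2 (abs_nonneg _)⟩
    have : Tendsto (fun t => |t - s|) (𝓝 s) (𝓝 |s - s|) :=
      (continuous_id.sub continuous_const).abs.tendsto s
    simp only [sub_self, abs_zero] at this
    exact this.mono_left nhdsWithin_le_nhds
  have hlim := ((hS.tendsto_Ici z).comp habs).sub_const z |>.norm.const_mul C
  simp only [Function.comp_def, sub_self, norm_zero, mul_zero] at hlim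
  refine squeeze_zero' (Eventually.of_forall fun t => norm_nonneg _) ?_ hlim
  filter_upwards [self_mem_nhdsWithin] with t ht
  rcases le_total s t with h | h
  · rw [abs_of_nonneg (sub_nonneg.2 h)]
    exact hle s t hs.1 h ht.2
  · rw [abs_sub_comm, abs_of_nonneg (sub_nonneg.2 h), norm_sub_rev]
    exact hle t s ht.1 h hs.2

theorem IsSemigroupGeneratedBy.tendsto_quotient (hS : IsSemigroupGeneratedBy gen S) {z w : X}
    (h : gen z w) {t : ℝ} (ht : 0 ≤ t) :
    Tendsto (fun r : ℝ => r⁻¹ • (S (t + r) z - S t z)) (𝓝[>] 0) (𝓝 (S t w)) := by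
  have := ((S t).continuous.tendsto w).comp ((hS.generator z w).1 h)
  refine this.congr' ?_
  filter_upwards [self_mem_nhdsWithin] with r hr
  rw [Function.comp_apply, map_smul, map_sub, hS.apply_add ht (le_of_lt hr)]

theorem IsSemigroupGeneratedBy.gen_apply (hS : IsSemigroupGeneratedBy gen S) {z w : X}
    (h : gen z w) {t : ℝ} (ht : 0 ≤ t) : gen (S t z) (S t w) := by
  refine (hS.generator _ _).2 ((hS.tendsto_quotient h ht).congr' ?_)
  filter_upwards [self_mem_nhdsWithin] with r hr
  rw [add_comm, hS.apply_add (le_of_lt hr) ht]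

theorem IsSemigroupGeneratedBy.hasDerivWithinAt (hS : IsSemigroupGeneratedBy gen S) {z w : X}
    (h : gen z w) {t : ℝ} (ht : 0 ≤ t) :
    HasDerivWithinAt (fun s => S s z) (S t w) (Ici t) t := by
  rw [← hasDerivWithinAt_Ioi_iff_Ici, hasDerivWithinAt_iff_tendsto_slope' (by simp)]
  have hshift : Tendsto (fun s => s - t) (𝓝[>] t) (𝓝[>] 0) := by
    refine tendsto_nhdsWithin_iff.2 ⟨?_, ?_⟩
    · have : Tendsto (fun s => s - t) (𝓝 t) (𝓝 (t - t)) :=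
        (continuous_id.sub continuous_const).tendsto t
      rw [sub_self] at this
      exact this.mono_left nhdsWithin_le_nhds
    · filter_upwards [self_mem_nhdsWithin] with s hs
      simpa using hs
  refine ((hS.tendsto_quotient h ht).comp hshift).congr fun s => ?_
  simp [slope_def_module]

end Semigroup

/-! ### Diagonal semigroups: existence and uniqueness -/

section Diagonal

variable {H : Type*} [NormedAddCommGroup H] [InnerProductSpace ℝ H] (e : HilbertBasis ℕ ℝ H)

theorem norm_exp_sub_one_le_two_mul {z : ℂ} (hz : z.re ≤ 0) : ‖Complex.exp z - 1‖ ≤ 2 * ‖z‖ := by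
  rcases le_total ‖z‖ 1 with h | h
  · exact Complex.norm_exp_sub_one_le h
  · refine (norm_sub_le _ _).trans ?_
    rw [Complex.norm_exp, norm_one]
    have := Real.exp_le_one_iff.2 hz
    linarith

theorem norm_exp_mul_le_one {s : ℂ} (hs : s.re ≤ 0) {t : ℝ} (ht : 0 ≤ t) :
    ‖Complex.exp (s * t)‖ ≤ 1 := by
  rw [Complex.norm_exp, Real.exp_le_one_iff]
  simpa using mul_nonpos_of_nonpos_of_nonneg hs ht

theorem hasDerivAt_exp_mul_ofReal (s : ℂ) (t : ℝ) :
    HasDerivAt (fun r : ℝ => Complex.exp (s * r)) (Complex.exp (s * t) * s) t := by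
  have := ((hasDerivAt_id (t : ℂ)).const_mul s).cexp.comp_ofReal
  simpa using this

theorem tendsto_exp_quotient (s : ℂ) :
    Tendsto (fun t : ℝ => (t : ℂ)⁻¹ * (Complex.exp (s * t) - 1)) (𝓝[>] 0) (𝓝 s) := by
  have h := (hasDerivAt_exp_mul_ofReal s 0).hasDerivWithinAt (s := Ioi 0)
  rw [hasDerivWithinAt_iff_tendsto_slope' (by simp)] at h
  refine Tendsto.congr (fun t => ?_) (by simpa using h)
  simp [slope_def_module]

/-- The semigroup multiplying the `i`-th coordinate by `exp (s i * t)`. -/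
noncomputable def diagonalSemigroup (s : ℕ → ℂ) (hs : ∀ i, (s i).re ≤ 0) (t : ℝ) :
    WithLp 2 (H × H) →L[ℝ] WithLp 2 (H × H) :=
  multiplier e (fun i => Complex.exp (s i * (max t 0 : ℝ)))
    fun i => norm_exp_mul_le_one (hs i) (le_max_right _ _)

theorem coord_diagonalSemigroup {s : ℕ → ℂ} (hs : ∀ i, (s i).re ≤ 0) {t : ℝ} (ht : 0 ≤ t)
    (z : WithLp 2 (H × H)) (i : ℕ) :
    coord e i (diagonalSemigroup e s hs t z) = Complex.exp (s i * t) * coord e i z := by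
  rw [diagonalSemigroup, coord_multiplier, max_eq_left ht]

/-- Coordinatewise everything is calculus of the exponential. The condition `Re s ≤ 0` supplies
dominations uniform in `t`, which turn coordinatewise limits into norm limits; conversely, a norm
limit of the difference quotients fixes every coordinate. -/
theorem isSemigroupGeneratedBy_diagonal {gen : WithLp 2 (H × H) → WithLp 2 (H × H) → Prop}
    {s : ℕ → ℂ} (hs : ∀ i, (s i).re ≤ 0)
    (hgen : ∀ y w, gen y w ↔ ∀ i, coord e i w = s i * coord e i y) :
    IsSemigroupGeneratedBy gen (diagonalSemigroup e s hs) where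
  zero := by
    ext1 z
    refine ext_coord (e := e) fun i => ?_
    simp [coord_diagonalSemigroup e hs le_rfl]
  add t r ht hr := by
    ext1 z
    refine ext_coord (e := e) fun i => ?_
    rw [ContinuousLinearMap.comp_apply, coord_diagonalSemigroup e hs (add_nonneg ht hr),
      coord_diagonalSemigroup e hs ht, coord_diagonalSemigroup e hs hr, Complex.ofReal_add,
      mul_add, Complex.exp_add, mul_assoc]
  continuous z := by
    rw [← tendsto_sub_nhds_zero_iff]
    refine tendsto_zero_of_coord e
      (g := fun i => 4 * ‖coord e i z‖ ^ 2) ((hasSum_norm_coord_sq e z).summable.mul_left 4) ?_ ?_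
    · filter_upwards [self_mem_nhdsWithin] with t ht i
      rw [map_sub, coord_diagonalSemigroup e hs (le_of_lt ht)]
      have h1 : ‖Complex.exp (s i * t) * coord e i z - coord e i z‖ ≤ 2 * ‖coord e i z‖ := by
        refine (norm_sub_le _ _).trans ?_
        rw [norm_mul]
        have := mul_le_of_le_one_left (norm_nonneg (coord e i z))
          (norm_exp_mul_le_one (hs i) (le_of_lt ht))
        linarith
      have := pow_le_pow_left₀ (norm_nonneg _) h1 2
      linarith
    · intro i
      have h1 : Tendsto (fun t : ℝ => Complex.exp (s i * t) * coord e i z - coord e i z)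
          (𝓝[>] 0) (𝓝 (Complex.exp (s i * (0 : ℝ)) * coord e i z - coord e i z)) :=
        (((hasDerivAt_exp_mul_ofReal (s i) 0).continuousAt.tendsto.mono_left
          nhdsWithin_le_nhds).mul_const _).sub_const _
      simp only [Complex.ofReal_zero, mul_zero, Complex.exp_zero, one_mul, sub_self] at h1
      refine h1.congr' ?_
      filter_upwards [self_mem_nhdsWithin] with t ht
      rw [map_sub, coord_diagonalSemigroup e hs (le_of_lt ht)]
  generator z w := by
    have hcoord : ∀ t : ℝ, 0 < t → ∀ i,
        coord e i (t⁻¹ • (diagonalSemigroup e s hs t z - z)) =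
          (t : ℂ)⁻¹ * (Complex.exp (s i * t) - 1) * coord e i z := by
      intro t ht i
      rw [map_smul, map_sub, coord_diagonalSemigroup e hs ht.le, Complex.real_smul]
      push_cast
      ring
    have hlim : ∀ i, Tendsto (fun t : ℝ => coord e i (t⁻¹ • (diagonalSemigroup e s hs t z - z)))
        (𝓝[>] 0) (𝓝 (s i * coord e i z)) := by
      intro i
      refine ((tendsto_exp_quotient (s i)).mul_const (coord e i z)).congr' ?_
      filter_upwards [self_mem_nhdsWithin] with t ht
      rw [hcoord t ht]
    rw [hgen]
    constructor
    · intro h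
      rw [← tendsto_sub_nhds_zero_iff]
      refine tendsto_zero_of_coord e
        (g := fun i => 9 * ‖coord e i w‖ ^ 2) ((hasSum_norm_coord_sq e w).summable.mul_left 9) ?_ ?_
      · filter_upwards [self_mem_nhdsWithin] with t ht i
        rw [map_sub, hcoord t ht, h i]
        have ht : 0 < t := ht
        have h1 : ‖(t : ℂ)⁻¹ * (Complex.exp (s i * t) - 1) * coord e i z‖ ≤
            2 * ‖s i * coord e i z‖ := by
          have h2 := norm_exp_sub_one_le_two_mul (z := s i * t)
            (by simpa using mul_nonpos_of_nonpos_of_nonneg (hs i) ht.le)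
          rw [norm_mul (s i), Complex.norm_real, Real.norm_of_nonneg ht.le] at h2
          rw [norm_mul, norm_mul, norm_mul, norm_inv, Complex.norm_real, Real.norm_of_nonneg ht.le,
            ← mul_assoc]
          refine mul_le_mul_of_nonneg_right ?_ (norm_nonneg _)
          rw [inv_mul_le_iff₀ ht]
          linarith
        have h3 := pow_le_pow_left₀ (norm_nonneg _) ((norm_sub_le _ (s i * coord e i z)).trans
          (add_le_add_left h1 _)) 2
        linarith
      · intro i
        simpa [map_sub, h i] using (hlim i).sub_const (s i * coord e i z)
    · intro h i
      exact tendsto_nhds_unique (((coord e i).continuous.tendsto w).comp h) (hlim i)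

variable [CompleteSpace H]

/-- For `z` in the domain, `exp (-s i r)` times the coordinate of `S r z` has zero right derivative,
hence is constant; density of the domain gives the rest. -/
theorem IsSemigroupGeneratedBy.coord_apply {gen : WithLp 2 (H × H) → WithLp 2 (H × H) → Prop}
    {s : ℕ → ℂ} (hgen : ∀ y w, gen y w ↔ ∀ i, coord e i w = s i * coord e i y)
    {S : ℝ → WithLp 2 (H × H) →L[ℝ] WithLp 2 (H × H)} (hS : IsSemigroupGeneratedBy gen S)
    {t : ℝ} (ht : 0 ≤ t) (z : WithLp 2 (H × H)) (i : ℕ) :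
    coord e i (S t z) = Complex.exp (s i * t) * coord e i z := by
  have hdom : ∀ z w, gen z w → coord e i (S t z) = Complex.exp (s i * t) * coord e i z := by
    intro z w h
    have hconst := constant_of_has_deriv_right_zero (a := 0) (b := t)
      (f := fun r : ℝ => Complex.exp (-s i * r) * coord e i (S r z)) ?_ ?_ t ⟨ht, le_rfl⟩
    · simp only [Complex.ofReal_zero, mul_zero, Complex.exp_zero, one_mul, hS.zero,
        ContinuousLinearMap.id_apply] at hconst
      rw [← hconst, ← mul_assoc, ← Complex.exp_add]
      simp
    · exact ContinuousOn.mul (by fun_prop)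
        ((coord e i).continuous.comp_continuousOn (hS.continuousOn t z))
    · intro r hr
      have h1 := (hasDerivAt_exp_mul_ofReal (-s i) r).hasDerivWithinAt (s := Ici r)
      have h2 := (coord e i).hasFDerivAt.comp_hasDerivWithinAt r (hS.hasDerivWithinAt h hr.1)
      have h3 := (hgen _ _).1 (hS.gen_apply h hr.1) i
      have h4 := h1.mul h2
      simp only [h3] at h4
      refine h4.congr_deriv ?_
      simp only [Function.comp_apply]
      ring
  have hm : ∀ n i : ℕ, ‖(if i < n then 1 else 0 : ℂ)‖ ≤ 1 := by
    intro n i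
    split_ifs <;> simp
  -- Truncation to the first `n` modes: its values lie in the domain, even for unbounded `s`, and
  -- approximate `z`.
  let P : ℕ → WithLp 2 (H × H) →L[ℝ] WithLp 2 (H × H) := fun n =>
    multiplier e (fun i => if i < n then 1 else 0) (hm n)
  have hP : Tendsto (fun n => P n z) atTop (𝓝 z) := by
    rw [← tendsto_sub_nhds_zero_iff]
    refine tendsto_zero_of_coord e (hasSum_norm_coord_sq e z).summable
      (Eventually.of_forall fun n j => ?_) fun j => ?_
    · simp only [P, map_sub, coord_multiplier]
      split_ifs <;> simp
    · refine tendsto_const_nhds.congr' ?_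
      filter_upwards [eventually_gt_atTop j] with n hn
      simp [P, coord_multiplier, hn]
  have hcl : IsClosed {y | coord e i (S t y) = Complex.exp (s i * t) * coord e i y} :=
    isClosed_eq ((coord e i).continuous.comp (S t).continuous)
      (continuous_const.mul (coord e i).continuous)
  refine hcl.mem_of_tendsto hP (Eventually.of_forall fun n => ?_)
  obtain ⟨w, hw⟩ := exists_coord_eq e (g := fun j => s j * coord e j (P n z)) (by
    refine summable_of_hasFiniteSupport ((Set.finite_lt_nat n).subset fun j hj => ?_)
    by_contra hjn
    refine hj ?_
    have : ¬ j < n := hjn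
    simp [P, coord_multiplier, this])
  exact hdom _ w ((hgen _ _).2 hw)

end Diagonal

/-! ### The coupled operator as multiplication by `-(a + ib)λ` -/

section Coupled

variable {d : ℕ} {Ω : Set (Space d)} {lam : ℕ → ℝ} {e : HilbertBasis ℕ ℝ (L2 Ω)}

/-- The eigenvalue `-(a + i b) λ` of the coupled operator in complex notation. -/
noncomputable def coupledRate (a b l : ℝ) : ℂ := -((a + b * Complex.I) * l)

theorem IsDirichletEigenbasis.hasCoupledOperator_iff (he : IsDirichletEigenbasis Ω lam e)
    (hlam : ∀ i, 0 < lam i) {a b : ℝ} (ha : 0 < a) (y w : L2Pair Ω) :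
    HasCoupledOperator Ω a b y w ↔
      ∀ i, coord e i w = coupledRate a b (lam i) * coord e i y := by
  have hpos : 0 < a ^ 2 + b ^ 2 := by positivity
  constructor
  · rintro ⟨f₁, f₂, h1, h2, h3, h4⟩ i
    rw [he.hasDirichletLaplacian_iff hlam] at h1 h2
    apply Complex.ext
    · simp only [coord_re, Complex.mul_re, coupledRate, coord_im, h3, inner_sub_right,
        real_inner_smul_right, h1 i, h2 i]
      simp
      ring
    · simp only [coord_re, Complex.mul_im, coupledRate, coord_im, h4, inner_add_right,
        real_inner_smul_right, h1 i, h2 i]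
      simp
      ring
  · intro h
    have hre : ∀ i, inner ℝ (e i) w.fst =
        -(lam i * (a * inner ℝ (e i) y.fst - b * inner ℝ (e i) y.snd)) := by
      intro i
      have := congrArg Complex.re (h i)
      simp [coord_re, coord_im, coupledRate] at this
      rw [this]
      ring
    have him : ∀ i, inner ℝ (e i) w.snd =
        -(lam i * (b * inner ℝ (e i) y.fst + a * inner ℝ (e i) y.snd)) := by
      intro i
      have := congrArg Complex.im (h i)
      simp [coord_re, coord_im, coupledRate] at this
      rw [this]
      ring
    -- The two Laplacians are recovered by inverting the matrix `[[a, -b], [b, a]]`.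
    refine ⟨(a ^ 2 + b ^ 2)⁻¹ • (a • w.fst + b • w.snd),
      (a ^ 2 + b ^ 2)⁻¹ • (a • w.snd - b • w.fst),
      (he.hasDirichletLaplacian_iff hlam _ _).2 fun i => ?_,
      (he.hasDirichletLaplacian_iff hlam _ _).2 fun i => ?_, ?_, ?_⟩
    · simp only [real_inner_smul_right, inner_add_right, hre, him]
      field_simp
      ring
    · simp only [real_inner_smul_right, inner_sub_right, hre, him]
      field_simp
      ring
    · match_scalars <;> field_simp <;> ring
    · match_scalars <;> field_simp <;> ring

theorem coupledRate_re (a b l : ℝ) : (coupledRate a b l).re = -(a * l) := by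
  simp [coupledRate]

theorem coupledRate_im (a b l : ℝ) : (coupledRate a b l).im = -(b * l) := by
  simp [coupledRate]

/-- The coupled semigroup acts diagonally on an eigenbasis. -/
theorem IsDirichletEigenbasis.coord_coupledSemigroup (he : IsDirichletEigenbasis Ω lam e)
    (hlam : ∀ i, 0 < lam i) {a b : ℝ} (ha : 0 < a) {t : ℝ} (ht : 0 ≤ t) (z : L2Pair Ω) (i : ℕ) :
    coord e i (coupledSemigroup Ω a b t z) =
      Complex.exp (coupledRate a b (lam i) * t) * coord e i z := by
  have hgen := he.hasCoupledOperator_iff hlam (b := b) ha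
  have hs : ∀ i, (coupledRate a b (lam i)).re ≤ 0 := fun i => by
    rw [coupledRate_re]
    exact neg_nonpos.2 (mul_pos ha (hlam i)).le
  -- The diagonal semigroup witnesses existence, so the `epsilon` choice is a genuine semigroup, to
  -- which uniqueness applies.
  have hS : IsSemigroupGeneratedBy (HasCoupledOperator Ω a b) (coupledSemigroup Ω a b) :=
    Classical.epsilon_spec ⟨_, isSemigroupGeneratedBy_diagonal e hs hgen⟩
  exact hS.coord_apply e hgen ht z i

end Coupled

/-! ### Sines on sets of times, and optimisation of the cut-off -/

section Elementary

/-- Jordan's inequality `|sin x| ≥ 2|x|/π`, after reduction to the nearest zero of the sine. -/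
theorem exists_int_abs_sub_lt_of_abs_sin_lt {s ε : ℝ} (h : |Real.sin s| < ε) :
    |s - round (s / Real.pi) * Real.pi| < Real.pi * ε / 2 := by
  have hπ := Real.pi_pos
  set k := round (s / Real.pi)
  have h1 : |s - k * Real.pi| ≤ Real.pi / 2 := by
    have := abs_sub_round (s / Real.pi)
    have h2 : s - k * Real.pi = (s / Real.pi - k) * Real.pi := by field_simp
    rw [h2, abs_mul, abs_of_pos hπ]
    nlinarith
  have h2 := Real.mul_abs_le_abs_sin h1
  have h3 : |Real.sin (s - k * Real.pi)| = |Real.sin s| := by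
    rw [Real.sin_sub_int_mul_pi, abs_mul, abs_zpow]
    simp
  rw [h3] at h2
  have h4 := h2.trans_lt h
  rw [div_mul_eq_mul_div, div_lt_iff₀ hπ] at h4
  linarith

/-- The times in `[0, L]` at which `sin (β t + φ)` is small form a small set. -/
theorem volume_abs_sin_lt_le {β L ε : ℝ} (hβ : 0 < β) (hL : 0 ≤ L) (hε : 0 < ε) (φ : ℝ) :
    volume {t ∈ Icc 0 L | |Real.sin (β * t + φ)| < ε} ≤
      ENNReal.ofReal (ε * (L + 2 * Real.pi / β)) := by
  have hπ := Real.pi_pos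
  set k₀ := round (φ / Real.pi) with hk₀
  set k₁ := round ((β * L + φ) / Real.pi) with hk₁
  -- Half-width of the bad interval around each zero; there are at most `β L / π + 2` relevant
  -- zeros.
  set r := Real.pi * ε / (2 * β) with hr
  have hrpos : 0 < r := by positivity
  have hmono : ∀ x y : ℝ, x ≤ y → round x ≤ round y := fun x y hxy => by
    rw [round_eq, round_eq]
    exact Int.floor_le_floor (by linarith)
  have hsub : {t ∈ Icc 0 L | |Real.sin (β * t + φ)| < ε} ⊆
      ⋃ k ∈ Finset.Icc k₀ k₁, Icc ((k * Real.pi - φ) / β - r) ((k * Real.pi - φ) / β + r) := by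
    rintro t ⟨ht, hs⟩
    have h1 := exists_int_abs_sub_lt_of_abs_sin_lt hs
    simp only [mem_iUnion, exists_prop]
    refine ⟨round ((β * t + φ) / Real.pi), Finset.mem_Icc.2 ⟨hmono _ _ ?_, hmono _ _ ?_⟩, ?_⟩
    · have := mul_nonneg hβ.le ht.1
      gcongr
      linarith
    · have := mul_le_mul_of_nonneg_left ht.2 hβ.le
      gcongr
    · set k := round ((β * t + φ) / Real.pi)
      have h2 : |t - (k * Real.pi - φ) / β| < r := by
        have : t - (k * Real.pi - φ) / β = (β * t + φ - k * Real.pi) / β := by field_simp; ring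
        rw [this, abs_div, abs_of_pos hβ, div_lt_iff₀ hβ, hr]
        refine h1.trans_eq ?_
        field_simp
      rw [abs_lt] at h2
      constructor <;> linarith [h2.1, h2.2]
  have hcard : ((Finset.Icc k₀ k₁).card : ℝ) ≤ β * L / Real.pi + 2 := by
    have h01 : k₀ ≤ k₁ := hmono _ _ (by
      have := mul_nonneg hβ.le hL
      gcongr
      linarith)
    have h1 : ((Finset.Icc k₀ k₁).card : ℤ) = k₁ + 1 - k₀ := by
      rw [Int.card_Icc]
      omega
    have h2 : ((Finset.Icc k₀ k₁).card : ℝ) = k₁ + 1 - k₀ := by exact_mod_cast h1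
    have h3 := (abs_le.1 (abs_sub_round (φ / Real.pi))).2
    have h4 := (abs_le.1 (abs_sub_round ((β * L + φ) / Real.pi))).1
    rw [add_div] at h4
    rw [h2, hk₁, hk₀, add_div]
    linarith
  calc volume {t ∈ Icc 0 L | |Real.sin (β * t + φ)| < ε}
      ≤ ∑ k ∈ Finset.Icc k₀ k₁,
          volume (Icc ((k * Real.pi - φ) / β - r) ((k * Real.pi - φ) / β + r)) :=
        (measure_mono hsub).trans (measure_biUnion_finset_le _ _)
    _ = (Finset.Icc k₀ k₁).card * ENNReal.ofReal (2 * r) := by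
        rw [← nsmul_eq_mul, ← Finset.sum_const]
        refine Finset.sum_congr rfl fun k _ => ?_
        rw [Real.volume_Icc]
        congr 1
        ring
    _ = ENNReal.ofReal ((Finset.Icc k₀ k₁).card * (2 * r)) := by
        rw [ENNReal.ofReal_mul (Nat.cast_nonneg _), ENNReal.ofReal_natCast]
    _ ≤ ENNReal.ofReal (ε * (L + 2 * Real.pi / β)) := by
        refine ENNReal.ofReal_le_ofReal ?_
        calc ((Finset.Icc k₀ k₁).card : ℝ) * (2 * r) ≤ (β * L / Real.pi + 2) * (2 * r) := by gcongr
          _ = ε * (L + 2 * Real.pi / β) := by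
            rw [hr]
            field_simp

/-- A lower bound for the integral of `sin²` over an arbitrary set of times. -/
theorem le_setIntegral_sin_sq_of_pos {β L : ℝ} (hβ : 0 < β) (hL : 0 ≤ L) (φ : ℝ) {F : Set ℝ}
    (hF : NullMeasurableSet F) (hFL : F ⊆ Icc 0 L) :
    volume.real F ^ 3 / (8 * (L + 2 * Real.pi / β) ^ 2) ≤
      ∫ t in F, Real.sin (β * t + φ) ^ 2 := by
  have hπ := Real.pi_pos
  set m := volume.real F with hm
  set K := L + 2 * Real.pi / β with hK
  have hKpos : 0 < K := by positivity
  rcases (measureReal_nonneg : 0 ≤ m).eq_or_lt with h0 | hmpos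
  · rw [hm, ← h0]
    simpa using integral_nonneg fun t => sq_nonneg _
  have hFtop : volume F ≠ ⊤ := ((measure_mono hFL).trans_lt measure_Icc_lt_top).ne
  -- With this threshold the bad times have measure at most `m / 2`, so `sin² ≥ ε²` on at least half
  -- of `F`.
  set ε := m / (2 * K) with hε
  have hεpos : 0 < ε := by positivity
  set B := {t ∈ Icc 0 L | |Real.sin (β * t + φ)| < ε} with hB
  have hBm : MeasurableSet B :=
    measurableSet_Icc.inter (measurableSet_lt
      (by fun_prop : Measurable fun t => |Real.sin (β * t + φ)|) measurable_const)
  have hBle : volume.real B ≤ m / 2 := by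
    refine ENNReal.toReal_le_of_le_ofReal (by positivity)
      ((volume_abs_sin_lt_le hβ hL hεpos φ).trans_eq ?_)
    congr 1
    rw [hε, ← hK]
    field_simp
  have hBtop : volume B ≠ ⊤ := ((measure_mono (sep_subset _ _)).trans_lt measure_Icc_lt_top).ne
  have hdiff : m / 2 ≤ volume.real (F \ B) := by
    have := le_measureReal_sdiff (μ := volume) (s₁ := F) (s₂ := B) hBtop
    linarith
  have hint : IntegrableOn (fun t => Real.sin (β * t + φ) ^ 2) F :=
    ((by fun_prop : Continuous fun t => Real.sin (β * t + φ) ^ 2).integrableOn_Icc).mono_set hFL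
  have hFB : NullMeasurableSet (F \ B) := hF.diff hBm.nullMeasurableSet
  calc m ^ 3 / (8 * K ^ 2) = (m / 2) * ε ^ 2 := by rw [hε]; field_simp; ring
    _ ≤ volume.real (F \ B) * ε ^ 2 := by gcongr
    _ = ∫ t in F \ B, ε ^ 2 := by rw [setIntegral_const, smul_eq_mul]
    _ ≤ ∫ t in F \ B, Real.sin (β * t + φ) ^ 2 := by
        refine setIntegral_mono_on₀ ?_ (hint.mono_set sdiff_subset) hFB fun t ht => ?_
        · exact integrableOn_const ((measure_mono sdiff_subset).trans_lt hFtop.lt_top).ne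
        · have h1 : ε ≤ |Real.sin (β * t + φ)| := by
            by_contra h
            exact ht.2 ⟨hFL ht.1, not_le.1 h⟩
          rw [← sq_abs (Real.sin _)]
          gcongr
    _ ≤ ∫ t in F, Real.sin (β * t + φ) ^ 2 :=
        setIntegral_mono_set hint (Eventually.of_forall fun t => sq_nonneg _)
          (Eventually.of_forall fun t ht => sdiff_subset ht)

/-- The bound for a single frequency improves as `|β|` grows, so the lowest frequency serves all
modes; a negative `β` only flips the phase. -/
theorem le_setIntegral_sin_sq {β β₀ L : ℝ} (hβ₀ : 0 < β₀) (hβ : β₀ ≤ |β|) (hL : 0 ≤ L) (φ : ℝ)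
    {F : Set ℝ} (hF : NullMeasurableSet F) (hFL : F ⊆ Icc 0 L) :
    volume.real F ^ 3 / (8 * (L + 2 * Real.pi / β₀) ^ 2) ≤
      ∫ t in F, Real.sin (β * t + φ) ^ 2 := by
  have hπ := Real.pi_pos
  have hpos : 0 < |β| := hβ₀.trans_le hβ
  have h1 : volume.real F ^ 3 / (8 * (L + 2 * Real.pi / β₀) ^ 2) ≤
      volume.real F ^ 3 / (8 * (L + 2 * Real.pi / |β|) ^ 2) := by
    gcongr
  rcases abs_choice β with h | h
  · rw [h] at h1 hpos
    exact h1.trans (le_setIntegral_sin_sq_of_pos hpos hL φ hF hFL)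
  · rw [h] at h1 hpos
    refine (h1.trans (le_setIntegral_sin_sq_of_pos hpos hL (-φ) hF hFL)).trans_eq ?_
    congr 1 with t
    rw [show -β * t + -φ = -(β * t + φ) by ring, Real.sin_neg, neg_sq]

/-- Optimising a frequency cut-off yields an interpolation inequality. -/
theorem le_rpow_of_forall_cutoff {Y Z N A c α θ : ℝ} (hA : 1 ≤ A) (hZ : 0 ≤ Z) (hN : 0 ≤ N)
    (hα : 0 < α) (hθ0 : 0 < θ) (hθ1 : θ < 1) (hYZ : Y ≤ Z)
    (h : ∀ Λ, 0 ≤ Λ → Y ≤ A * Real.exp (c * √Λ) * (N + Real.exp (-(α * Λ)) * Z)) :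
    Y ≤ 2 * A * Real.exp (c ^ 2 / (4 * θ * α)) * N ^ (1 - θ) * Z ^ θ := by
  set q := Real.exp (c ^ 2 / (4 * θ * α)) with hq
  have hq1 : 1 ≤ q := Real.one_le_exp (by positivity)
  -- A positive majorant `n` replaces `N`, which may vanish; the claim follows by letting `n`
  -- decrease to `N`.
  have key : ∀ n, 0 < n → N ≤ n → Y ≤ 2 * A * q * n ^ (1 - θ) * Z ^ θ := by
    intro n hn hNn
    rcases hZ.eq_or_lt with rfl | hZpos
    · exact hYZ.trans (by positivity)
    rcases le_total Z n with hle | hle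
    · have h1 : Z = Z ^ (1 - θ) * Z ^ θ := by
        rw [← Real.rpow_add hZpos]; simp
      have h2 : Z ^ (1 - θ) ≤ n ^ (1 - θ) := Real.rpow_le_rpow hZ hle (by linarith)
      have h3 : 1 ≤ 2 * A * q := by nlinarith
      calc Y ≤ 1 * (Z ^ (1 - θ) * Z ^ θ) := by rw [one_mul, ← h1]; exact hYZ
        _ ≤ (2 * A * q) * (n ^ (1 - θ) * Z ^ θ) := by gcongr
        _ = _ := by ring
    -- The cut-off `Λ = x / α` balances the two terms, `exp (-αΛ) Z = n`. Completing a square then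
    -- bounds `c √Λ` by `θ x` plus a constant, and `exp (θ x) n = n ^ (1 - θ) * Z ^ θ`.
    · set x := Real.log (Z / n) with hx
      have hx0 : 0 ≤ x := Real.log_nonneg ((one_le_div hn).2 hle)
      have hexp : Real.exp (-x) * Z = n := by
        rw [Real.exp_neg, hx, Real.exp_log (by positivity)]
        field_simp
      have h1 := h (x / α) (by positivity)
      have h2 : c * √(x / α) ≤ θ * x + c ^ 2 / (4 * θ * α) := by
        have hs := Real.sq_sqrt (show 0 ≤ x / α by positivity)
        set s := √(x / α)
        have hx' : x = α * s ^ 2 := by rw [hs]; field_simp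
        have : 0 ≤ (2 * θ * α * s - c) ^ 2 / (4 * θ * α) := by positivity
        have h4 : (2 * θ * α * s - c) ^ 2 / (4 * θ * α) =
            θ * (α * s ^ 2) + c ^ 2 / (4 * θ * α) - c * s := by
          field_simp
          ring
        rw [hx']
        linarith
      have h3 : α * (x / α) = x := by field_simp
      rw [h3, hexp] at h1
      have h5 : Real.exp (θ * x) * n = n ^ (1 - θ) * Z ^ θ := by
        rw [mul_comm θ, Real.exp_mul, hx, Real.exp_log (by positivity), Real.div_rpow hZ hn.le,
          Real.rpow_sub hn, Real.rpow_one]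
        ring
      calc Y ≤ A * Real.exp (c * √(x / α)) * (N + n) := h1
        _ ≤ A * Real.exp (θ * x + c ^ 2 / (4 * θ * α)) * (n + n) := by gcongr
        _ = 2 * A * q * (Real.exp (θ * x) * n) := by rw [Real.exp_add]; ring
        _ = _ := by rw [h5]; ring
  have hcont : Continuous fun n : ℝ => 2 * A * q * n ^ (1 - θ) * Z ^ θ := by
    have := Real.continuous_rpow_const (q := 1 - θ) (by linarith)
    fun_prop
  refine ge_of_tendsto ((hcont.tendsto N).mono_left nhdsWithin_le_nhds)
    (?_ : ∀ᶠ n in 𝓝[>] N, _)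
  filter_upwards [self_mem_nhdsWithin] with n hn
  exact key n (hN.trans_lt hn) (le_of_lt hn)

end Elementary

/-! ### The local `L¹` norm and its integrability in time -/

section LocalNorm

variable {d : ℕ} {Ω U : Set (Space d)}

theorem localL1Norm_nonneg (Ω U : Set (Space d)) (f : Space d → ℝ) : 0 ≤ localL1Norm Ω U f :=
  integral_nonneg fun _ => indicator_nonneg (fun _ _ => abs_nonneg _) _

theorem localL1Norm_congr_ae {f g : Space d → ℝ} (h : f =ᵐ[volume.restrict Ω] g) :
    localL1Norm Ω U f = localL1Norm Ω U g := by
  refine integral_congr_ae ?_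
  filter_upwards [h] with x hx
  simp only [indicator, hx]

theorem observation_eq (μ₁ μ₂ : ℝ) (y : L2Pair Ω) :
    observation Ω U μ₁ μ₂ y = localL1Norm Ω U (μ₁ • y.fst + μ₂ • y.snd : L2 Ω) := by
  refine localL1Norm_congr_ae ?_
  filter_upwards [Lp.coeFn_add (μ₁ • y.fst) (μ₂ • y.snd), Lp.coeFn_smul μ₁ y.fst,
    Lp.coeFn_smul μ₂ y.snd] with x h1 h2 h3
  rw [h1, Pi.add_apply, h2, h3]
  rfl

theorem coeFn_sum_smul (n : ℕ) (c : ℕ → ℝ) (v : ℕ → L2 Ω) :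
    (fun x => ∑ i ∈ Finset.range n, c i * v i x) =ᵐ[volume.restrict Ω]
      (∑ i ∈ Finset.range n, c i • v i : L2 Ω) := by
  induction n with
  | zero =>
    filter_upwards [Lp.coeFn_zero ℝ 2 (volume.restrict Ω)] with x hx
    simpa using hx.symm
  | succ n ih =>
    rw [Finset.sum_range_succ]
    filter_upwards [ih, Lp.coeFn_add (∑ i ∈ Finset.range n, c i • v i) (c n • v n),
      Lp.coeFn_smul (c n) (v n)] with x h1 h2 h3
    rw [Finset.sum_range_succ, h1, h2, Pi.add_apply, h3]
    rfl

variable [IsFiniteMeasure (volume.restrict Ω)]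

theorem integrable_indicator_abs (hU : NullMeasurableSet U) (f : L2 Ω) :
    Integrable (U.indicator fun x => |f x|) (volume.restrict Ω) :=
  ((Lp.memLp f).integrable (by norm_num)).abs.indicator₀
    (hU.mono_ac Measure.restrict_le_self.absolutelyContinuous)

theorem localL1Norm_add_le (hU : NullMeasurableSet U) (f g : L2 Ω) :
    localL1Norm Ω U (f + g : L2 Ω) ≤ localL1Norm Ω U f + localL1Norm Ω U g := by
  rw [localL1Norm, localL1Norm, localL1Norm,
    ← integral_add (integrable_indicator_abs hU f) (integrable_indicator_abs hU g)]
  refine integral_mono_ae (integrable_indicator_abs hU _)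
    ((integrable_indicator_abs hU f).add (integrable_indicator_abs hU g)) ?_
  filter_upwards [Lp.coeFn_add f g] with x hx
  by_cases h : x ∈ U
  · simp only [indicator_of_mem h, hx]
    exact abs_add_le (f x) (g x)
  · simp [h]

variable (Ω) in
/-- The norm in `L²(Ω)` of the constant function `1`. -/
noncomputable def volumeNorm : ℝ := ‖Lp.const 2 (volume.restrict Ω) (1 : ℝ)‖

theorem volumeNorm_nonneg : 0 ≤ volumeNorm Ω := norm_nonneg _

theorem localL1Norm_le (hU : NullMeasurableSet U) (f : L2 Ω) :
    localL1Norm Ω U f ≤ volumeNorm Ω * ‖f‖ := by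
  have h1 : localL1Norm Ω U f ≤ ∫ x in Ω, |f x| :=
    integral_mono (integrable_indicator_abs hU f)
      ((Lp.memLp f).integrable (by norm_num)).abs fun x =>
        indicator_le_self' (fun _ _ => abs_nonneg _) x
  have h2 : ∫ x in Ω, |f x| =
      inner ℝ (Lp.const 2 (volume.restrict Ω) (1 : ℝ)) |f| := by
    rw [L2.inner_def]
    refine integral_congr_ae ?_
    filter_upwards [Lp.coeFn_const (p := 2) (μ := volume.restrict Ω) (1 : ℝ), Lp.coeFn_abs f]
      with x hx hf
    rw [hx, hf]
    simp
  rw [h2] at h1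
  exact h1.trans ((real_inner_le_norm _ _).trans_eq (by rw [norm_abs_eq_norm]; rfl))

theorem localL1Norm_sub_le (hU : NullMeasurableSet U) (f g : L2 Ω) :
    localL1Norm Ω U f ≤ localL1Norm Ω U g + volumeNorm Ω * ‖f - g‖ := by
  have h1 := localL1Norm_add_le hU g (f - g)
  rw [add_sub_cancel] at h1
  exact h1.trans (add_le_add_right (localL1Norm_le hU _) _)

theorem tendsto_localL1Norm {ι : Type*} {l : Filter ι} {f : ι → L2 Ω} {g : L2 Ω}
    (hU : NullMeasurableSet U) (h : Tendsto f l (𝓝 g)) :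
    Tendsto (fun n => localL1Norm Ω U (f n)) l (𝓝 (localL1Norm Ω U g)) := by
  rw [tendsto_iff_norm_sub_tendsto_zero] at h ⊢
  refine squeeze_zero (fun n => norm_nonneg _) (fun n => ?_)
    (by simpa using h.const_mul (volumeNorm Ω))
  have h1 := localL1Norm_sub_le hU (f n) g
  have h2 := localL1Norm_sub_le hU g (f n)
  rw [norm_sub_rev] at h2
  rw [Real.norm_eq_abs, abs_le]
  constructor <;> linarith

/-- Observations through the moving sets are integrable in time. -/
theorem integrableOn_localL1Norm {T : ℝ} {𝒟 : ℝ → Set (Space d)} (e : HilbertBasis ℕ ℝ (L2 Ω))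
    (hm : ∀ᵐ t : ℝ, t ∈ Ioo 0 T → NullMeasurableSet (𝒟 t) volume)
    (hint : ∀ f : Space d × ℝ → ℝ,
      Integrable f ((volume.restrict Ω).prod (volume.restrict (Ioo 0 T))) →
      IntegrableOn (fun t => localL1Norm Ω (𝒟 t) (fun x => f (x, t))) (Ioo 0 T) volume)
    {h : ℝ → L2 Ω} (hc : ∀ i, ContinuousOn (fun t => inner ℝ (e i) (h t)) (Icc 0 T)) {B : ℝ}
    (hB : ∀ t ∈ Ioo 0 T, ‖h t‖ ≤ B) :
    IntegrableOn (fun t => localL1Norm Ω (𝒟 t) (h t)) (Ioo 0 T) volume := by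
  have hpart : ∀ n : ℕ, IntegrableOn (fun t => localL1Norm Ω (𝒟 t)
      (∑ i ∈ Finset.range n, inner ℝ (e i) (h t) • e i : L2 Ω)) (Ioo 0 T) volume := by
    intro n
    -- The hypothesis on the moving sets concerns functions on the product space. Finite expansions
    -- are sums of products, hence integrable there; measurability for `h` itself follows by a limit
    -- in `n`.
    have := hint (fun p => ∑ i ∈ Finset.range n, inner ℝ (e i) (h p.2) * e i p.1) ?_
    · refine this.congr (Eventually.of_forall fun t => ?_)
      exact localL1Norm_congr_ae (coeFn_sum_smul n (fun i => inner ℝ (e i) (h t)) e)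
    · refine integrable_finsetSum _ fun i _ => ?_
      have h1 : Integrable (e i) (volume.restrict Ω) := (Lp.memLp (e i)).integrable (by norm_num)
      have h2 : Integrable (fun t => inner ℝ (e i) (h t)) (volume.restrict (Ioo 0 T)) :=
        (hc i).integrableOn_Icc.mono_set Ioo_subset_Icc_self
      simpa only [mul_comm] using h1.mul_prod h2
  have hm' := (ae_restrict_iff' measurableSet_Ioo).2 hm
  have hmeas : AEStronglyMeasurable (fun t => localL1Norm Ω (𝒟 t) (h t))
      (volume.restrict (Ioo 0 T)) := by
    refine aestronglyMeasurable_of_tendsto_ae atTop (fun n => (hpart n).aestronglyMeasurable) ?_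
    filter_upwards [hm'] with t ht
    refine tendsto_localL1Norm ht ?_
    have := (e.hasSum_repr (h t)).tendsto_sum_nat
    simpa only [e.repr_apply_apply] using this
  refine Integrable.mono' (g := fun _ => volumeNorm Ω * B) (integrableOn_const (by simp)) hmeas ?_
  filter_upwards [hm', ae_restrict_mem measurableSet_Ioo] with t ht hmem
  rw [Real.norm_of_nonneg (localL1Norm_nonneg _ _ _)]
  exact (localL1Norm_le ht _).trans (mul_le_mul_of_nonneg_left (hB t hmem) volumeNorm_nonneg)

end LocalNorm

/-! ### Observed modes and spectral cut-offs -/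

section Observation

variable {H : Type*} [NormedAddCommGroup H] [InnerProductSpace ℝ H] (e : HilbertBasis ℕ ℝ H)

theorem norm_sub_sum_sq (v : H) (n : ℕ) :
    ‖v - ∑ i ∈ Finset.range n, inner ℝ (e i) v • e i‖ ^ 2 = ∑' i, inner ℝ (e (i + n)) v ^ 2 := by
  have horth := orthonormal_iff_ite.1 e.orthonormal
  have hcoef : ∀ i, inner ℝ (e i) (v - ∑ j ∈ Finset.range n, inner ℝ (e j) v • e j) =
      if i < n then 0 else inner ℝ (e i) v := by
    intro i
    rw [inner_sub_right, inner_sum]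
    simp only [real_inner_smul_right, horth, mul_ite, mul_one, mul_zero, Finset.sum_ite_eq,
      Finset.mem_range]
    split_ifs <;> simp
  have h1 := hasSum_inner_sq e (v - ∑ j ∈ Finset.range n, inner ℝ (e j) v • e j)
  simp only [hcoef] at h1
  rw [← h1.tsum_eq, ← h1.summable.sum_add_tsum_nat_add n, Finset.sum_eq_zero, zero_add]
  · simp
  · intro i hi
    simp [Finset.mem_range.1 hi]

theorem inner_observation (μ₁ μ₂ : ℝ) (y : WithLp 2 (H × H)) (i : ℕ) :
    inner ℝ (e i) (μ₁ • y.fst + μ₂ • y.snd) = μ₁ * (coord e i y).re + μ₂ * (coord e i y).im := by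
  rw [inner_add_right, real_inner_smul_right, real_inner_smul_right, coord_re, coord_im]

theorem sq_add_le_norm_sq (μ₁ μ₂ : ℝ) (c : ℂ) :
    (μ₁ * c.re + μ₂ * c.im) ^ 2 ≤ (μ₁ ^ 2 + μ₂ ^ 2) * ‖c‖ ^ 2 := by
  rw [← Complex.normSq_eq_norm_sq, Complex.normSq_apply]
  nlinarith [sq_nonneg (μ₁ * c.im - μ₂ * c.re)]

/-- An observed mode is a damped sine wave of the maximal amplitude. -/
theorem exists_phase (μ₁ μ₂ a b l : ℝ) (c : ℂ) : ∃ φ : ℝ, ∀ t : ℝ,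
    μ₁ * (Complex.exp (coupledRate a b l * t) * c).re +
      μ₂ * (Complex.exp (coupledRate a b l * t) * c).im =
    √(μ₁ ^ 2 + μ₂ ^ 2) * ‖Complex.exp (coupledRate a b l * t) * c‖ *
      Real.sin (b * l * t + φ) := by
  -- The functional `μ₁ Re w + μ₂ Im w` is the real part of `(μ₁ - μ₂ I) w`, so the phase is read
  -- off from `arg q`.
  set q : ℂ := (μ₁ - μ₂ * Complex.I) * c with hq
  have hnorm : ‖q‖ = √(μ₁ ^ 2 + μ₂ ^ 2) * ‖c‖ := by
    rw [hq, norm_mul, Complex.norm_def (_ - _), Complex.normSq_apply]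
    congr 2
    simp
    ring
  refine ⟨Real.pi / 2 - q.arg, fun t => ?_⟩
  have h1 : μ₁ * (Complex.exp (coupledRate a b l * t) * c).re +
      μ₂ * (Complex.exp (coupledRate a b l * t) * c).im =
      (Complex.exp (coupledRate a b l * t) * q).re := by
    simp [hq]
    ring
  have h2 : Complex.exp (coupledRate a b l * t) * q =
      ‖q‖ * Complex.exp (coupledRate a b l * t + q.arg * Complex.I) := by
    conv_lhs => rw [← Complex.norm_mul_exp_arg_mul_I q]
    rw [Complex.exp_add]
    ring
  rw [h1, h2, Complex.re_ofReal_mul, Complex.exp_re, norm_mul (Complex.exp _), Complex.norm_exp,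
    hnorm]
  have h3 : (coupledRate a b l * t + q.arg * Complex.I).im = -(b * l * t - q.arg) := by
    simp [coupledRate_im]
    ring
  have h4 : (coupledRate a b l * t + q.arg * Complex.I).re = (coupledRate a b l * t).re := by
    simp
  rw [h3, h4, Real.cos_neg, ← Real.sin_add_pi_div_two]
  ring_nf

/-- Cauchy–Schwarz with `σ⁴ ≤ σ²`. The right side is linear in the `ℓ²` norm of the observed values,
as needed for a time integral of `L¹` norms rather than of their squares. -/
theorem sum_mul_le_sqrt_mul_sqrt {ι : Type*} (s : Finset ι) (r σ k : ι → ℝ)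
    (hσ : ∀ i ∈ s, |σ i| ≤ 1) (hk : ∀ i ∈ s, r i ^ 2 * σ i ^ 2 ≤ k i ^ 2) :
    ∑ i ∈ s, r i ^ 2 * σ i ^ 2 ≤ √(∑ i ∈ s, r i ^ 2) * √(∑ i ∈ s, k i ^ 2) := by
  have h1 := Finset.sum_mul_sq_le_sq_mul_sq s r (fun i => r i * σ i ^ 2)
  have h2 : ∑ i ∈ s, (r i * σ i ^ 2) ^ 2 ≤ ∑ i ∈ s, k i ^ 2 := by
    refine Finset.sum_le_sum fun i hi => le_trans ?_ (hk i hi)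
    have h3 : σ i ^ 2 ≤ 1 := (sq_le_one_iff_abs_le_one _).2 (hσ i hi)
    have h4 : 0 ≤ r i ^ 2 * σ i ^ 2 := by positivity
    nlinarith
  have h5 : ∑ i ∈ s, r i * (r i * σ i ^ 2) = ∑ i ∈ s, r i ^ 2 * σ i ^ 2 :=
    Finset.sum_congr rfl fun i _ => by ring
  rw [h5] at h1
  rw [← Real.sqrt_mul (Finset.sum_nonneg fun i _ => sq_nonneg _)]
  refine Real.le_sqrt_of_sq_le (h1.trans ?_)
  exact mul_le_mul_of_nonneg_left h2 (Finset.sum_nonneg fun i _ => sq_nonneg _)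

/-- A spectral cut-off at frequency `Λ`. The eigenvalues need not tend to infinity here. -/
theorem exists_cutoff {lam : ℕ → ℝ} (hmono : Monotone lam) {a b L Λ : ℝ} (ha : 0 < a)
    (hlam : ∀ i, 0 < lam i) {z : WithLp 2 (H × H)} (hz : z ≠ 0) {S : ℝ → WithLp 2 (H × H)}
    (hS : ∀ t, 0 ≤ t → ∀ i, coord e i (S t) = Complex.exp (coupledRate a b (lam i) * t) *
      coord e i z) (hΛ : 0 ≤ Λ) :
    ∃ n, (∀ i < n, lam i ≤ Λ) ∧ ∀ t, 0 ≤ t → t ≤ L →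
      ∑' i, ‖coord e (i + n) (S t)‖ ^ 2 ≤ (Real.exp (-(a * Λ * t)) * ‖z‖) ^ 2 := by
  have hnorm : ∀ t, 0 ≤ t → ∀ i, ‖coord e i (S t)‖ ^ 2 =
      Real.exp (-(a * lam i * t)) ^ 2 * ‖coord e i z‖ ^ 2 := by
    intro t ht i
    rw [hS t ht i, norm_mul, Complex.norm_exp, mul_pow]
    congr 3
    simp [coupledRate_re]
  have hz' := hasSum_norm_coord_sq e z
  have hsum : ∀ n t, Summable fun i => ‖coord e (i + n) (S t)‖ ^ 2 := fun n t =>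
    (summable_nat_add_iff n).2 (hasSum_norm_coord_sq e (S t)).summable
  have hsumz : ∀ n, Summable fun i => ‖coord e (i + n) z‖ ^ 2 := fun n =>
    (summable_nat_add_iff n).2 hz'.summable
  by_cases hex : ∃ i, Λ < lam i
  · classical
    refine ⟨Nat.find hex, fun i hi => not_lt.1 (Nat.find_min hex hi), fun t ht _ => ?_⟩
    set n := Nat.find hex
    have h1 : ∀ i, ‖coord e (i + n) (S t)‖ ^ 2 ≤
        Real.exp (-(a * Λ * t)) ^ 2 * ‖coord e (i + n) z‖ ^ 2 := by
      intro i
      rw [hnorm t ht]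
      have : Λ ≤ lam (i + n) := (Nat.find_spec hex).le.trans (hmono (Nat.le_add_left n i))
      gcongr
    refine ((hsum n t).tsum_le_tsum h1 ((hsumz n).mul_left _)).trans ?_
    rw [tsum_mul_left, mul_pow]
    refine mul_le_mul_of_nonneg_left ?_ (sq_nonneg _)
    rw [← hz'.tsum_eq, ← hz'.summable.sum_add_tsum_nat_add n]
    exact le_add_of_nonneg_left (Finset.sum_nonneg fun i _ => sq_nonneg _)
  -- If no eigenvalue exceeds `Λ`, any `n` is admissible; one is taken so large that the tail of `z`
  -- is below the smallest value of the bound on `[0, L]`. This uses `z ≠ 0`.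
  · push Not at hex
    have hpos : 0 < (Real.exp (-(a * Λ * L)) * ‖z‖) ^ 2 := by
      have := norm_pos_iff.2 hz
      positivity
    obtain ⟨n, hn⟩ := ((tendsto_sum_nat_add fun i => ‖coord e i z‖ ^ 2).eventually_lt_const
      hpos).exists
    refine ⟨n, fun i _ => hex i, fun t ht htL => ?_⟩
    have h1 : ∀ i, ‖coord e (i + n) (S t)‖ ^ 2 ≤ ‖coord e (i + n) z‖ ^ 2 := by
      intro i
      rw [hnorm t ht]
      refine mul_le_of_le_one_left (sq_nonneg _) (pow_le_one₀ (Real.exp_pos _).le ?_)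
      rw [Real.exp_le_one_iff, neg_nonpos]
      have := hlam (i + n)
      positivity
    refine ((hsum n t).tsum_le_tsum h1 (hsumz n)).trans (hn.le.trans ?_)
    gcongr

end Observation

/-- Recovering amplitudes of finitely many oscillating modes from their values on a set of
times of positive measure. -/
theorem sqrt_sum_sq_mul_le_setIntegral {n : ℕ} {r β φ : ℕ → ℝ} {k : ℕ → ℝ → ℝ} {G : ℝ → ℝ}
    {β₀ L : ℝ} {F : Set ℝ} (hβ₀ : 0 < β₀) (hβ : ∀ i, β₀ ≤ |β i|) (hL : 0 ≤ L)
    (hF : NullMeasurableSet F) (hFL : F ⊆ Icc 0 L)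
    (hk : ∀ t ∈ F, ∀ i, r i ^ 2 * Real.sin (β i * t + φ i) ^ 2 ≤ k i t ^ 2)
    (hG : IntegrableOn G F)
    (h : ∀ᵐ t ∂volume.restrict F, √(∑ i ∈ Finset.range n, k i t ^ 2) ≤ G t) :
    √(∑ i ∈ Finset.range n, r i ^ 2) *
      (volume.real F ^ 3 / (8 * (L + 2 * Real.pi / β₀) ^ 2)) ≤ ∫ t in F, G t := by
  set C := √(∑ i ∈ Finset.range n, r i ^ 2) with hC
  set c := volume.real F ^ 3 / (8 * (L + 2 * Real.pi / β₀) ^ 2) with hc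
  have hsq : C ^ 2 = ∑ i ∈ Finset.range n, r i ^ 2 :=
    Real.sq_sqrt (Finset.sum_nonneg fun i _ => sq_nonneg _)
  rcases (Real.sqrt_nonneg _ : 0 ≤ C).eq_or_lt with h0 | hpos
  · rw [hC, ← h0, zero_mul]
    exact integral_nonneg_of_ae (h.mono fun t ht => (Real.sqrt_nonneg _).trans ht)
  have hint : ∀ i, IntegrableOn (fun t => r i ^ 2 * Real.sin (β i * t + φ i) ^ 2) F := fun i =>
    ((by fun_prop : Continuous fun t => r i ^ 2 * Real.sin (β i * t + φ i) ^ 2).integrableOn_Icc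
      ).mono_set hFL
  -- After multiplication by `C`, the left side becomes a sum of squared amplitudes, to which the
  -- `sin²` bound applies mode by mode.
  refine le_of_mul_le_mul_left ?_ hpos
  calc C * (C * c) = ∑ i ∈ Finset.range n, r i ^ 2 * c := by
        rw [← Finset.sum_mul, ← hsq]
        ring
    _ ≤ ∑ i ∈ Finset.range n, ∫ t in F, r i ^ 2 * Real.sin (β i * t + φ i) ^ 2 := by
        refine Finset.sum_le_sum fun i _ => ?_
        rw [integral_const_mul]
        exact mul_le_mul_of_nonneg_left (le_setIntegral_sin_sq hβ₀ (hβ i) hL (φ i) hF hFL)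
          (sq_nonneg _)
    _ = ∫ t in F, ∑ i ∈ Finset.range n, r i ^ 2 * Real.sin (β i * t + φ i) ^ 2 :=
        (integral_finsetSum _ fun i _ => hint i).symm
    _ ≤ ∫ t in F, C * G t := by
        refine integral_mono_ae (integrable_finsetSum _ fun i _ => hint i) (hG.const_mul C) ?_
        filter_upwards [h, ae_restrict_mem₀ hF] with t ht htF
        refine (sum_mul_le_sqrt_mul_sqrt (Finset.range n) r (fun i => Real.sin (β i * t + φ i))
          (fun i => k i t) (fun i _ => Real.abs_sin_le_one _) fun i _ => hk t htF i).trans ?_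
        exact mul_le_mul_of_nonneg_left ht hpos.le
    _ = C * ∫ t in F, G t := integral_const_mul _ _

/-! ### From a fixed cut-off to the interpolation estimate -/

section Estimate

variable {d : ℕ} {Ω : Set (Space d)} {lam : ℕ → ℝ} {e : HilbertBasis ℕ ℝ (L2 Ω)}
  {a b μ₁ μ₂ D : ℝ}

theorem IsDirichletEigenbasis.norm_coupledSemigroup_le (he : IsDirichletEigenbasis Ω lam e)
    (hlam : ∀ i, 0 < lam i) (ha : 0 < a) {t : ℝ} (ht : 0 ≤ t) (z : L2Pair Ω) :
    ‖coupledSemigroup Ω a b t z‖ ≤ Real.exp (-(a * lam 0 * t)) * ‖z‖ := by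
  refine abs_le_of_sq_le_sq' ?_ (by positivity) |>.2
  rw [mul_pow]
  refine hasSum_le (fun i => ?_) (hasSum_norm_coord_sq e _)
    ((hasSum_norm_coord_sq e z).mul_left _)
  rw [he.coord_coupledSemigroup hlam ha ht, norm_mul, Complex.norm_exp, mul_pow]
  have h1 : (coupledRate a b (lam i) * t).re = -(a * lam i * t) := by simp [coupledRate_re]
  have h2 : lam 0 ≤ lam i := he.monotone (Nat.zero_le i)
  rw [h1]
  gcongr

theorem norm_sq_le_of_tail_le (z : L2Pair Ω) (n : ℕ) {x : ℝ} (hx : 0 ≤ x)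
    (h : ∑' i, ‖coord e (i + n) z‖ ^ 2 ≤ x ^ 2) :
    ‖z‖ ≤ √(∑ i ∈ Finset.range n, ‖coord e i z‖ ^ 2) + x := by
  have hz := hasSum_norm_coord_sq e z
  have h0 : 0 ≤ ∑ i ∈ Finset.range n, ‖coord e i z‖ ^ 2 := Finset.sum_nonneg fun i _ => sq_nonneg _
  have hs := Real.sqrt_nonneg (∑ i ∈ Finset.range n, ‖coord e i z‖ ^ 2)
  refine abs_le_of_sq_le_sq' ?_ (by positivity) |>.2
  rw [← hz.tsum_eq, ← hz.summable.sum_add_tsum_nat_add n, add_sq, Real.sq_sqrt h0]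
  nlinarith [mul_nonneg hs hx]

variable [IsFiniteMeasure (volume.restrict Ω)]

/-- At a time where the spectral inequality holds, the low frequencies of `h` are controlled by
the observation of `h` and by its high frequencies. -/
theorem SpectralInequality.sqrt_sum_le {U : Set (Space d)} (hU : NullMeasurableSet U)
    (hD : 0 < D) (hspec : SpectralInequality Ω lam e D U) {Λ : ℝ} (hΛ : lam 0 < Λ) {n : ℕ}
    (hn : ∀ i < n, lam i ≤ Λ) (h : L2 Ω) {x : ℝ} (hx : 0 ≤ x)
    (htail : ∑' i, inner ℝ (e (i + n)) h ^ 2 ≤ x ^ 2) :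
    √(∑ i ∈ Finset.range n, inner ℝ (e i) h ^ 2) ≤
      √D * Real.exp (D / 2 * √Λ) * (localL1Norm Ω U h + volumeNorm Ω * x) := by
  have h1 := hspec Λ hΛ n hn fun i => inner ℝ (e i) h
  rw [localL1Norm_congr_ae (coeFn_sum_smul n (fun i => inner ℝ (e i) h) e)] at h1
  have h2 := localL1Norm_sub_le hU (∑ i ∈ Finset.range n, inner ℝ (e i) h • e i) h
  rw [norm_sub_rev] at h2
  have h3 : ‖h - ∑ i ∈ Finset.range n, inner ℝ (e i) h • e i‖ ≤ x := by
    refine abs_le_of_sq_le_sq' ?_ hx |>.2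
    rwa [norm_sub_sum_sq]
  have h4 := h2.trans (add_le_add_right (mul_le_mul_of_nonneg_left h3 volumeNorm_nonneg) _)
  have hexp : Real.exp (D * √Λ) = Real.exp (D / 2 * √Λ) ^ 2 := by
    rw [← Real.exp_nat_mul]
    congr 1
    push_cast
    ring
  have h0 := localL1Norm_nonneg Ω U (∑ i ∈ Finset.range n, inner ℝ (e i) h • e i : L2 Ω)
  refine le_trans ?_ (mul_le_mul_of_nonneg_left h4 (by positivity))
  rw [Real.sqrt_le_left (by positivity)]
  refine h1.trans_eq ?_
  rw [hexp, mul_pow, mul_pow, Real.sq_sqrt hD.le]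

/-- The estimate at a fixed frequency cut-off `Λ`. -/
theorem IsDirichletEigenbasis.norm_le_of_cutoff (he : IsDirichletEigenbasis Ω lam e) {κ : ℝ}
    (hκ : 0 < κ) (hlam : ∀ i, κ ≤ lam i) (ha : 0 < a) (hb : b ≠ 0) (hμ : 0 < μ₁ ^ 2 + μ₂ ^ 2)
    (hD : 0 < D) {F : Set ℝ} {S₁ S₂ : ℝ} (hS₁ : 0 < S₁) (hS : S₁ < S₂)
    (hF : NullMeasurableSet F) (hFS : F ⊆ Icc S₁ S₂) (hm : 0 < volume.real F)
    {𝒟 : ℝ → Set (Space d)} (h𝒟 : ∀ᵐ t ∂volume.restrict F, NullMeasurableSet (𝒟 t))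
    (hspec : ∀ᵐ t ∂volume.restrict F, SpectralInequality Ω lam e D (𝒟 t)) {z : L2Pair Ω}
    (hz : z ≠ 0)
    (hobs : IntegrableOn (fun t => observation Ω (𝒟 t) μ₁ μ₂ (coupledSemigroup Ω a b t z)) F)
    {Λ : ℝ} (hΛ : lam 0 < Λ) :
    ‖coupledSemigroup Ω a b S₂ z‖ ≤
      8 * (S₂ + 2 * Real.pi / (|b| * κ)) ^ 2 * √D / √(μ₁ ^ 2 + μ₂ ^ 2) / volume.real F ^ 2 *
        Real.exp (D / 2 * √Λ) *
        (1 / volume.real F *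
          (∫ t in F, observation Ω (𝒟 t) μ₁ μ₂ (coupledSemigroup Ω a b t z)) +
          volumeNorm Ω * √(μ₁ ^ 2 + μ₂ ^ 2) * (Real.exp (-(a * S₁ * Λ)) * ‖z‖)) +
      Real.exp (-(a * S₁ * Λ)) * ‖z‖ := by
  have hπ := Real.pi_pos
  have hpos : ∀ i, 0 < lam i := fun i => hκ.trans_le (hlam i)
  have hS₂ : 0 < S₂ := hS₁.trans hS
  set y := fun t => coupledSemigroup Ω a b t z with hy
  have hcoord : ∀ t, 0 ≤ t → ∀ i, coord e i (y t) =
      Complex.exp (coupledRate a b (lam i) * t) * coord e i z := fun t ht i =>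
    he.coord_coupledSemigroup hpos ha ht z i
  obtain ⟨n, hn, htail⟩ := exists_cutoff e he.monotone (L := S₂) ha hpos hz hcoord
    ((hpos 0).trans hΛ).le
  set m := volume.real F with hm_def
  set p := √(μ₁ ^ 2 + μ₂ ^ 2) with hp
  have hppos : 0 < p := Real.sqrt_pos.2 hμ
  have hpsq : p ^ 2 = μ₁ ^ 2 + μ₂ ^ 2 := Real.sq_sqrt hμ.le
  set x := Real.exp (-(a * S₁ * Λ)) * ‖z‖ with hx
  have hx0 : 0 ≤ x := by positivity
  have hβ₀ : 0 < |b| * κ := mul_pos (abs_pos.2 hb) hκ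
  set K := S₂ + 2 * Real.pi / (|b| * κ) with hK
  have hKpos : 0 < K := by positivity
  set h : ℝ → L2 Ω := fun t => μ₁ • (y t).fst + μ₂ • (y t).snd with hh
  have hΛ0 : 0 ≤ Λ := ((hpos 0).trans hΛ).le
  have htail' : ∀ t, S₁ ≤ t → t ≤ S₂ → ∑' i, ‖coord e (i + n) (y t)‖ ^ 2 ≤ x ^ 2 := by
    intro t h1 h2
    refine (htail t (hS₁.le.trans h1) h2).trans ?_
    rw [hx]
    have : a * S₁ * Λ ≤ a * Λ * t := by
      have := mul_le_mul_of_nonneg_left h1 (mul_nonneg ha.le hΛ0)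
      linarith
    gcongr
  have htailh : ∀ t, S₁ ≤ t → t ≤ S₂ →
      ∑' i, inner ℝ (e (i + n)) (h t) ^ 2 ≤ (p * x) ^ 2 := by
    intro t h1 h2
    have hs := (summable_nat_add_iff n).2 (hasSum_norm_coord_sq e (y t)).summable
    have hs' := (summable_nat_add_iff n).2 (hasSum_inner_sq e (h t)).summable
    refine (hs'.tsum_le_tsum (fun i => ?_) (hs.mul_left (p ^ 2))).trans ?_
    · rw [hh, inner_observation, hpsq]
      exact sq_add_le_norm_sq _ _ _
    · rw [tsum_mul_left, mul_pow]
      exact mul_le_mul_of_nonneg_left (htail' t h1 h2) (sq_nonneg _)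
  choose φ hφ using fun i => exists_phase μ₁ μ₂ a b (lam i) (coord e i z)
  have hFtop : volume F ≠ ⊤ := ((measure_mono hFS).trans_lt measure_Icc_lt_top).ne
  have hconst : IntegrableOn (fun _ : ℝ => volumeNorm Ω * (p * x)) F := integrableOn_const hFtop
  -- The amplitudes `r` are frozen at the final time `S₂`: by dissipation they lie below the actual
  -- amplitudes at all earlier times of `F`.
  have key := sqrt_sum_sq_mul_le_setIntegral (n := n) (F := F)
    (r := fun i => p * ‖coord e i (y S₂)‖) (β := fun i => b * lam i) (φ := φ)
    (k := fun i t => inner ℝ (e i) (h t))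
    (G := fun t => √D * Real.exp (D / 2 * √Λ) *
      (observation Ω (𝒟 t) μ₁ μ₂ (y t) + volumeNorm Ω * (p * x)))
    hβ₀ (fun i => ?_) hS₂.le hF (hFS.trans (Icc_subset_Icc_left hS₁.le)) (fun t ht i => ?_)
    ((hobs.add hconst).const_mul _) ?_
  rotate_left
  · rw [abs_mul, abs_of_pos (hpos i)]
    exact mul_le_mul_of_nonneg_left (hlam i) (abs_nonneg b)
  · have ht0 : 0 ≤ t := hS₁.le.trans (hFS ht).1
    rw [hh, inner_observation, hcoord t ht0, hφ i t, mul_pow _ (Real.sin _), ← hp]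
    refine mul_le_mul_of_nonneg_right ?_ (sq_nonneg _)
    rw [hcoord S₂ hS₂.le]
    simp only [norm_mul, Complex.norm_exp, Complex.re_mul_ofReal, coupledRate_re]
    have h1 : a * lam i * t ≤ a * lam i * S₂ :=
      mul_le_mul_of_nonneg_left (hFS ht).2 (mul_pos ha (hpos i)).le
    refine pow_le_pow_left₀ (by positivity) (mul_le_mul_of_nonneg_left
      (mul_le_mul_of_nonneg_right (Real.exp_le_exp.2 ?_) (norm_nonneg _)) hppos.le) 2
    linarith
  · filter_upwards [h𝒟, hspec, ae_restrict_mem₀ hF] with t h1 h2 h3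
    rw [observation_eq]
    exact h2.sqrt_sum_le h1 hD hΛ hn (h t) (by positivity)
      (htailh t (hFS h3).1 (hFS h3).2)
  rw [integral_const_mul, integral_add hobs hconst, setIntegral_const, smul_eq_mul,
    ← hm_def] at key
  set I := ∫ t in F, observation Ω (𝒟 t) μ₁ μ₂ (y t) with hI
  have hsum : √(∑ i ∈ Finset.range n, (p * ‖coord e i (y S₂)‖) ^ 2) =
      p * √(∑ i ∈ Finset.range n, ‖coord e i (y S₂)‖ ^ 2) := by
    simp only [mul_pow]
    rw [← Finset.mul_sum, Real.sqrt_mul (sq_nonneg p), Real.sqrt_sq hppos.le]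
  rw [hsum] at key
  refine (norm_sq_le_of_tail_le (y S₂) n hx0 (htail' S₂ hS.le le_rfl)).trans
    (add_le_add_left ?_ x)
  set C := √(∑ i ∈ Finset.range n, ‖coord e i (y S₂)‖ ^ 2)
  have hfac : 0 < p * (m ^ 3 / (8 * K ^ 2)) := by positivity
  rw [← mul_le_mul_iff_left₀ hfac]
  calc C * (p * (m ^ 3 / (8 * K ^ 2))) = p * C * (m ^ 3 / (8 * K ^ 2)) := by ring
    _ ≤ _ := key
    _ = _ := by
      field_simp

theorem IsDirichletEigenbasis.integrableOn_observation (he : IsDirichletEigenbasis Ω lam e)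
    (hlam : ∀ i, 0 < lam i) (ha : 0 < a) {T : ℝ} {𝒟 : ℝ → Set (Space d)}
    (hm : ∀ᵐ t : ℝ, t ∈ Ioo 0 T → NullMeasurableSet (𝒟 t) volume)
    (hint : ∀ f : Space d × ℝ → ℝ,
      Integrable f ((volume.restrict Ω).prod (volume.restrict (Ioo 0 T))) →
      IntegrableOn (fun t => localL1Norm Ω (𝒟 t) (fun x => f (x, t))) (Ioo 0 T) volume)
    (z : L2Pair Ω) :
    IntegrableOn (fun t => observation Ω (𝒟 t) μ₁ μ₂ (coupledSemigroup Ω a b t z))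
      (Ioo 0 T) volume := by
  simp only [observation_eq]
  refine integrableOn_localL1Norm e hm hint (B := (|μ₁| + |μ₂|) * ‖z‖) (fun i => ?_) fun t ht => ?_
  · have hc : ContinuousOn (fun t : ℝ =>
        μ₁ * (Complex.exp (coupledRate a b (lam i) * t) * coord e i z).re +
        μ₂ * (Complex.exp (coupledRate a b (lam i) * t) * coord e i z).im) (Icc 0 T) := by
      fun_prop
    refine hc.congr fun t ht => ?_
    rw [inner_observation, he.coord_coupledSemigroup hlam ha ht.1]
  · have h1 := he.norm_coupledSemigroup_le (b := b) hlam ha ht.1.le z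
    have h2 : Real.exp (-(a * lam 0 * t)) ≤ 1 := by
      rw [Real.exp_le_one_iff, neg_nonpos]
      have := hlam 0
      have := ht.1
      positivity
    have h3 := h1.trans (mul_le_of_le_one_left (norm_nonneg z) h2)
    set y := coupledSemigroup Ω a b t z
    have h4 : ‖y.fst‖ ≤ ‖z‖ := (WithLp.norm_fst_le _ y).trans h3
    have h5 : ‖y.snd‖ ≤ ‖z‖ := (WithLp.norm_snd_le _ y).trans h3
    refine (norm_add_le _ _).trans ?_
    rw [norm_smul, norm_smul, Real.norm_eq_abs, Real.norm_eq_abs, add_mul]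
    gcongr

/-- The interpolation estimate with explicit constants. -/
theorem IsDirichletEigenbasis.norm_le_interpolation (he : IsDirichletEigenbasis Ω lam e) {κ : ℝ}
    (hκ : 0 < κ) (hlam : ∀ i, κ ≤ lam i) (ha : 0 < a) (hb : b ≠ 0) (hμ : 0 < μ₁ ^ 2 + μ₂ ^ 2)
    (hD : 0 < D) {F : Set ℝ} {S₁ S₂ : ℝ} (hS₁ : 0 < S₁) (hS : S₁ < S₂)
    (hF : NullMeasurableSet F) (hFS : F ⊆ Icc S₁ S₂) (hm : 0 < volume.real F)
    {𝒟 : ℝ → Set (Space d)} (h𝒟 : ∀ᵐ t ∂volume.restrict F, NullMeasurableSet (𝒟 t))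
    (hspec : ∀ᵐ t ∂volume.restrict F, SpectralInequality Ω lam e D (𝒟 t)) {z : L2Pair Ω}
    (hobs : IntegrableOn (fun t => observation Ω (𝒟 t) μ₁ μ₂ (coupledSemigroup Ω a b t z)) F)
    {K : ℝ} (hK : K = 8 * (1 + 2 * Real.pi / (|b| * κ)) ^ 2 * √D / √(μ₁ ^ 2 + μ₂ ^ 2) *
      (1 + volumeNorm Ω * √(μ₁ ^ 2 + μ₂ ^ 2)) + 1) {θ : ℝ} (hθ0 : 0 < θ) (hθ1 : θ < 1) :
    ‖coupledSemigroup Ω a b S₂ z‖ ≤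
      2 * (K * (S₂ + 1) ^ 2 / volume.real F ^ 2) *
        Real.exp ((D / 2) ^ 2 / (4 * θ * (a * S₁))) *
        (1 / volume.real F *
          ∫ t in F, observation Ω (𝒟 t) μ₁ μ₂ (coupledSemigroup Ω a b t z)) ^ (1 - θ) *
        ‖z‖ ^ θ := by
  have hπ := Real.pi_pos
  have hpos : ∀ i, 0 < lam i := fun i => hκ.trans_le (hlam i)
  have hS₂ : 0 < S₂ := hS₁.trans hS
  have hbpos : 0 < |b| := abs_pos.2 hb
  have hppos : 0 < √(μ₁ ^ 2 + μ₂ ^ 2) := Real.sqrt_pos.2 hμ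
  have hV := volumeNorm_nonneg (Ω := Ω)
  have hN : 0 ≤ 1 / volume.real F *
      ∫ t in F, observation Ω (𝒟 t) μ₁ μ₂ (coupledSemigroup Ω a b t z) :=
    mul_nonneg (by positivity) (integral_nonneg fun t => localL1Norm_nonneg _ _ _)
  have hcut := fun (hz : z ≠ 0) (Λ : ℝ) (hΛ : lam 0 < Λ) => he.norm_le_of_cutoff hκ hlam ha hb hμ hD
    hS₁ hS hF hFS hm h𝒟 hspec hz hobs hΛ
  have hdecay := he.norm_coupledSemigroup_le (b := b) hpos ha hS₂.le z
  have hmS : volume.real F ≤ S₂ + 1 := by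
    have h1 : volume.real F ≤ volume.real (Icc S₁ S₂) := measureReal_mono hFS (by simp)
    rw [Real.volume_real_Icc_of_le hS.le] at h1
    linarith
  set m := volume.real F
  set p := √(μ₁ ^ 2 + μ₂ ^ 2)
  set N := 1 / m * ∫ t in F, observation Ω (𝒟 t) μ₁ μ₂ (coupledSemigroup Ω a b t z)
  set V := volumeNorm Ω
  set k := 1 + 2 * Real.pi / (|b| * κ) with hk
  have hk1 : 0 < 2 * Real.pi / (|b| * κ) := by positivity
  -- Makes the common prefactor at least `1`, so that it absorbs the bare high-frequency term; the
  -- `+ 1` in `K` is reserved for that term.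
  have hP : 1 ≤ (S₂ + 1) ^ 2 / m ^ 2 := by
    rw [one_le_div (by positivity)]
    gcongr
  have hK0 : 0 ≤ 8 * k ^ 2 * √D / p := by positivity
  have hK1 : 1 ≤ K := by
    rw [hK]
    have : 0 ≤ 8 * k ^ 2 * √D / p * (1 + V * p) := by positivity
    linarith
  have hA : 1 ≤ K * (S₂ + 1) ^ 2 / m ^ 2 := by
    rw [mul_div_assoc]
    exact one_le_mul_of_one_le_of_one_le hK1 hP
  refine le_rpow_of_forall_cutoff hA (norm_nonneg z) hN (mul_pos ha hS₁) hθ0 hθ1 ?_ fun Λ hΛ => ?_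
  · refine hdecay.trans (mul_le_of_le_one_left (norm_nonneg z) ?_)
    rw [Real.exp_le_one_iff, neg_nonpos]
    have := hpos 0
    positivity
  · set x := Real.exp (-(a * S₁ * Λ)) * ‖z‖ with hx
    have hx0 : 0 ≤ x := by positivity
    set E := Real.exp (D / 2 * √Λ)
    have hE : 1 ≤ E := Real.one_le_exp (by positivity)
    have hAE : 1 ≤ K * (S₂ + 1) ^ 2 / m ^ 2 * E := one_le_mul_of_one_le_of_one_le hA hE
    rcases eq_or_ne z 0 with rfl | hz
    · rw [map_zero, norm_zero]
      positivity
    -- The spectral inequality covers only `Λ > lam 0`; below that threshold the decay of the whole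
    -- solution already gives the bound.
    rcases le_or_gt Λ (lam 0) with hle | hlt
    · have h1 : ‖coupledSemigroup Ω a b S₂ z‖ ≤ x := by
        refine hdecay.trans (mul_le_mul_of_nonneg_right (Real.exp_le_exp.2 ?_) (norm_nonneg z))
        have : S₁ * Λ ≤ S₂ * lam 0 := mul_le_mul hS.le hle hΛ hS₂.le
        have := mul_le_mul_of_nonneg_left this ha.le
        linarith
      exact h1.trans ((le_add_of_nonneg_left hN).trans
        (le_mul_of_one_le_left (add_nonneg hN hx0) hAE))
    · refine (hcut hz Λ hlt).trans ?_
      have hkS : (S₂ + 2 * Real.pi / (|b| * κ)) ^ 2 ≤ k ^ 2 * (S₂ + 1) ^ 2 := by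
        rw [← mul_pow]
        refine pow_le_pow_left₀ (by positivity) ?_ 2
        have := mul_nonneg hk1.le hS₂.le
        rw [hk]
        linarith
      have h1 : 8 * (S₂ + 2 * Real.pi / (|b| * κ)) ^ 2 * √D / p / m ^ 2 ≤
          8 * k ^ 2 * √D / p * ((S₂ + 1) ^ 2 / m ^ 2) := by
        calc 8 * (S₂ + 2 * Real.pi / (|b| * κ)) ^ 2 * √D / p / m ^ 2
            ≤ 8 * (k ^ 2 * (S₂ + 1) ^ 2) * √D / p / m ^ 2 := by gcongr
          _ = _ := by ring
      have h2 : N + V * p * x ≤ (1 + V * p) * (N + x) := by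
        have : 0 ≤ V * p * N := by positivity
        linarith
      have h3 : x ≤ (S₂ + 1) ^ 2 / m ^ 2 * E * (N + x) :=
        (le_add_of_nonneg_left hN).trans (le_mul_of_one_le_left (add_nonneg hN hx0)
          (one_le_mul_of_one_le_of_one_le hP hE))
      calc _ ≤ 8 * k ^ 2 * √D / p * ((S₂ + 1) ^ 2 / m ^ 2) * E * ((1 + V * p) * (N + x)) +
            (S₂ + 1) ^ 2 / m ^ 2 * E * (N + x) := by gcongr
        _ = K * (S₂ + 1) ^ 2 / m ^ 2 * E * (N + x) := by rw [hK]; ring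

end Estimate

end CoupledHeat

/-! ### Choice of the constant and conclusion -/

theorem proposition3p6 {d : ℕ} (hd : 1 ≤ d) (Ω : Set (CoupledHeat.Space d))
    (hΩ_open : IsOpen Ω) (hΩ_conn : IsConnected Ω) (hΩ_bdd : Bornology.IsBounded Ω)
    (a b : ℝ) (ha : 0 < a) (hb : b ≠ 0)
    (μ₁ μ₂ : ℝ) (hμ : |μ₁| + |μ₂| ≠ 0) (D : ℝ) (hD : 0 < D) :
    ∃ M : ℝ, 0 < M ∧
      ∀ (lam : ℕ → ℝ) (e : HilbertBasis ℕ ℝ (CoupledHeat.L2 Ω)),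
        CoupledHeat.IsDirichletEigenbasis Ω lam e →
      ∀ (T : ℝ) (E : Set ℝ) (𝒟 : ℝ → Set (CoupledHeat.Space d)),
        0 < T → E ⊆ Ioo 0 T → NullMeasurableSet E volume → 0 < volume E →
        (∀ t ∈ Ioo 0 T, 𝒟 t ⊆ Ω) →
        (∀ᵐ t : ℝ, t ∈ Ioo 0 T → NullMeasurableSet (𝒟 t) volume) →
        (∀ f : CoupledHeat.Space d × ℝ → ℝ,
          Integrable f ((volume.restrict Ω).prod (volume.restrict (Ioo 0 T))) →
          IntegrableOn (fun t => CoupledHeat.localL1Norm Ω (𝒟 t) (fun x => f (x, t)))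
            (Ioo 0 T) volume) →
        (∀ᵐ t : ℝ, t ∈ E → CoupledHeat.SpectralInequality Ω lam e D (𝒟 t)) →
      ∀ θ S₁ S₂ : ℝ, 0 < θ → θ < 1 → 0 < S₁ → S₁ < S₂ → S₂ ≤ T →
        volume (E ∩ Icc S₁ S₂) ≠ 0 →
      ∀ z : CoupledHeat.L2Pair Ω,
        IntervalIntegrable
          (E.indicator fun t => CoupledHeat.observation Ω (𝒟 t) μ₁ μ₂
            (CoupledHeat.coupledSemigroup Ω a b t z)) volume S₁ S₂ ∧
        ‖CoupledHeat.coupledSemigroup Ω a b S₂ z‖ ≤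
          M * Real.exp (M * (S₂ / (1 - θ) + 1 / (θ * S₁))) / volume.real (E ∩ Icc S₁ S₂) ^ 3 *
          (1 / volume.real (E ∩ Icc S₁ S₂) *
            ∫ t in S₁..S₂, E.indicator (fun t => CoupledHeat.observation Ω (𝒟 t) μ₁ μ₂
              (CoupledHeat.coupledSemigroup Ω a b t z)) t) ^ (1 - θ) *
          ‖z‖ ^ θ := by
  obtain ⟨R, hRpos, hR⟩ := hΩ_bdd.exists_pos_norm_le
  have hfin : IsFiniteMeasure (volume.restrict Ω) :=
    ⟨by simpa using hΩ_bdd.measure_lt_top⟩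
  have hμ' : 0 < μ₁ ^ 2 + μ₂ ^ 2 := by
    by_contra h
    have h1 : μ₁ ^ 2 = 0 := by nlinarith [sq_nonneg μ₁, sq_nonneg μ₂]
    have h2 : μ₂ ^ 2 = 0 := by nlinarith [sq_nonneg μ₁, sq_nonneg μ₂]
    rw [pow_eq_zero_iff two_ne_zero] at h1 h2
    exact hμ (by simp [h1, h2])
  set κ : ℝ := 1 / (4 * R ^ 2) with hκ_def
  have hκ : 0 < κ := by positivity
  obtain ⟨K, hK⟩ : ∃ K, K = 8 * (1 + 2 * Real.pi / (|b| * κ)) ^ 2 * √D / √(μ₁ ^ 2 + μ₂ ^ 2) *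
    (1 + CoupledHeat.volumeNorm Ω * √(μ₁ ^ 2 + μ₂ ^ 2)) + 1 := ⟨_, rfl⟩
  have hK1 : 0 < K := by
    have := CoupledHeat.volumeNorm_nonneg (Ω := Ω)
    have := Real.pi_pos
    rw [hK]
    positivity
  -- The summands dominate, in turn, the prefactor, the exponent in `(S₂ + 1)³ ≤ exp (3 S₂)`, and
  -- the coefficient of `1 / (θ S₁)` left by the optimisation.
  refine ⟨2 * K + 3 + D ^ 2 / (16 * a), by positivity, ?_⟩
  intro lam e he T E 𝒟 hT hET hE hEpos h𝒟 h𝒟m hint hspec θ S₁ S₂ hθ0 hθ1 hS₁ hS hST hEne z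
  have hlam : ∀ i, κ ≤ lam i := fun i => by
    rw [hκ_def, div_le_iff₀ (by positivity)]
    linarith [he.eigenvalue_ge hd hR i]
  have hpos : ∀ i, 0 < lam i := fun i => hκ.trans_le (hlam i)
  have hobs := he.integrableOn_observation (μ₁ := μ₁) (μ₂ := μ₂) (b := b) hpos ha h𝒟m hint z
  have hS₂ : 0 < S₂ := hS₁.trans hS
  set obs := fun t => CoupledHeat.observation Ω (𝒟 t) μ₁ μ₂
    (CoupledHeat.coupledSemigroup Ω a b t z) with hobs_def
  refine ⟨((hobs.mono_set hET).integrable_indicator₀ hE).intervalIntegrable, ?_⟩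
  set F := E ∩ Icc S₁ S₂ with hF_def
  have hF : NullMeasurableSet F := hE.inter measurableSet_Icc.nullMeasurableSet
  have hFS : F ⊆ Icc S₁ S₂ := inter_subset_right
  have hFE : F ⊆ E := inter_subset_left
  have hFtop : volume F ≠ ⊤ := ((measure_mono hFS).trans_lt measure_Icc_lt_top).ne
  have hm : 0 < volume.real F := ENNReal.toReal_pos hEne hFtop
  have hmS : volume.real F ≤ S₂ := by
    have h1 : volume.real F ≤ volume.real (Icc S₁ S₂) := measureReal_mono hFS (by simp)
    rw [Real.volume_real_Icc_of_le hS.le] at h1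
    linarith
  have hinteg : ∫ t in S₁..S₂, E.indicator obs t = ∫ t in F, obs t := by
    rw [intervalIntegral.integral_of_le hS.le, ← integral_Icc_eq_integral_Ioc,
      integral_indicator₀ (hE.mono_ac Measure.restrict_le_self.absolutelyContinuous),
      Measure.restrict_restrict₀ (hE.mono_ac Measure.restrict_le_self.absolutelyContinuous)]
  have main := he.norm_le_interpolation hκ hlam ha hb hμ' hD hS₁ hS hF hFS hm
    ((ae_restrict_iff'₀ hF).2 (h𝒟m.mono fun t ht htF => ht (hET (hFE htF))))
    ((ae_restrict_iff'₀ hF).2 (hspec.mono fun t ht htF => ht (hFE htF)))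
    (hobs.mono_set (hFE.trans hET)) hK hθ0 hθ1
  rw [hinteg]
  refine main.trans ?_
  have hN : 0 ≤ ∫ t in F, obs t := integral_nonneg fun t => CoupledHeat.localL1Norm_nonneg _ _ _
  set m := volume.real F
  set M := 2 * K + 3 + D ^ 2 / (16 * a) with hM
  have h16 : 0 ≤ D ^ 2 / (16 * a) := by positivity
  have h1θ : 0 < 1 - θ := by linarith
  have hpre : 2 * (K * (S₂ + 1) ^ 2 / m ^ 2) * Real.exp ((D / 2) ^ 2 / (4 * θ * (a * S₁))) ≤
      M * Real.exp (M * (S₂ / (1 - θ) + 1 / (θ * S₁))) / m ^ 3 := by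
    -- The estimate obtained has `m⁻²`; writing it as `m · m⁻³` costs a factor `m ≤ S₂`, absorbed by
    -- the exponential.
    have h1 : (S₂ + 1) ^ 2 * m ≤ Real.exp (3 * (S₂ / (1 - θ))) := by
      have h2 : S₂ + 1 ≤ Real.exp S₂ := Real.add_one_le_exp S₂
      have h3 : S₂ ≤ S₂ / (1 - θ) := le_div_self hS₂.le h1θ (by linarith)
      calc (S₂ + 1) ^ 2 * m ≤ (S₂ + 1) ^ 2 * (S₂ + 1) := by gcongr; linarith
        _ = (S₂ + 1) ^ 3 := by ring
        _ ≤ Real.exp S₂ ^ 3 := by gcongr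
        _ = Real.exp (3 * S₂) := by rw [← Real.exp_nat_mul]; norm_num
        _ ≤ _ := by gcongr
    have h2 : (D / 2) ^ 2 / (4 * θ * (a * S₁)) = D ^ 2 / (16 * a) * (1 / (θ * S₁)) := by
      field_simp
      norm_num
    have h3 : 3 * (S₂ / (1 - θ)) + D ^ 2 / (16 * a) * (1 / (θ * S₁)) ≤
        M * (S₂ / (1 - θ) + 1 / (θ * S₁)) := by
      rw [mul_add]
      gcongr <;> linarith
    calc 2 * (K * (S₂ + 1) ^ 2 / m ^ 2) * Real.exp ((D / 2) ^ 2 / (4 * θ * (a * S₁)))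
        = 2 * K * (((S₂ + 1) ^ 2 * m) *
            Real.exp (D ^ 2 / (16 * a) * (1 / (θ * S₁)))) / m ^ 3 := by
          rw [h2]
          field_simp
      _ ≤ M * (Real.exp (3 * (S₂ / (1 - θ))) *
            Real.exp (D ^ 2 / (16 * a) * (1 / (θ * S₁)))) / m ^ 3 := by
          gcongr
          linarith
      _ ≤ M * Real.exp (M * (S₂ / (1 - θ) + 1 / (θ * S₁))) / m ^ 3 := by
          rw [← Real.exp_add]
          gcongr
  gcongr
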